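/- Let $n\ge 1$, let $\varphi$ be an arbitrary norm on $\mathbb R^n$ with dual norm $\varphi^*$, let $\Omega\subset\mathbb R^n$ be an open set and let $m\in[0,+\infty)$. For $v\in L^1(\mathbb R^n)$ define $$\int_\Omega \varphi^*(Dv):=\sup\Big\{\int_\Omega v\,\operatorname{div}\eta\,dx:\ \eta\in C^1_c(\mathbb R^n;\mathbb R^n),\ \varphi(\eta(x))\le 1\ \text{for all }x\Big\}$$ (the test fields need not vanish on $\partial\Omega$). Suppose that $u$ is a minimizer of the problem $$\min\Big\{\int_\Omega\varphi^*(Du):\ u\in BV(\mathbb R^n),\ u=0 \text{ a.e. on }\mathbb R^n\setminus\Omega,\ u(x)\in\{0,1,2,\dots\}\text{ for a.e. }x,\ \int_\Omega u\,dx=m\Big\}.$$ Then $u\in L^\infty(\mathbb R^n)$. -/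

import Mathlib

open MeasureTheory
open scoped ENNReal

noncomputable section

namespace AnisoBV

/-- The divergence of a vector field on `ℝⁿ`. -/
def divergence {n : ℕ} (η : EuclideanSpace ℝ (Fin n) → EuclideanSpace ℝ (Fin n))
    (x : EuclideanSpace ℝ (Fin n)) : ℝ :=
  ∑ i, (fderiv ℝ η x (EuclideanSpace.single i 1)) i

/-- Admissible test fields for the norm `φ`: compactly supported `C¹` vector fields on the whole
of `ℝⁿ` with `φ(η) ≤ 1` everywhere. -/
def IsTestField {n : ℕ} (φ : Seminorm ℝ (EuclideanSpace ℝ (Fin n)))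
    (η : EuclideanSpace ℝ (Fin n) → EuclideanSpace ℝ (Fin n)) : Prop :=
  ContDiff ℝ 1 η ∧ HasCompactSupport η ∧ ∀ x, φ (η x) ≤ 1

/-- The anisotropic total variation `∫_Ω φ*(Dv)`, with `φ*` the dual norm of `φ`, namely the
supremum of `∫_Ω v div η` over the test fields `η`. The test fields need not vanish on the boundary
of `Ω`. As `η = 0` is a test field the supremum is nonnegative, and it is taken in `[0, ∞]`. -/
def variation {n : ℕ} (φ : Seminorm ℝ (EuclideanSpace ℝ (Fin n)))
    (Ω : Set (EuclideanSpace ℝ (Fin n))) (v : EuclideanSpace ℝ (Fin n) → ℝ) : ℝ≥0∞ :=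
  ⨆ (η : EuclideanSpace ℝ (Fin n) → EuclideanSpace ℝ (Fin n)) (_ : IsTestField φ η),
    ENNReal.ofReal (∫ x in Ω, v x * divergence η x)

/-- `u ∈ BV(ℝⁿ)`: `u` is integrable and has finite (Euclidean) total variation on `ℝⁿ`. -/
def IsBV {n : ℕ} (u : EuclideanSpace ℝ (Fin n) → ℝ) : Prop :=
  Integrable u ∧ variation (normSeminorm ℝ (EuclideanSpace ℝ (Fin n))) Set.univ u < ∞

/-- The competitors: `u ∈ BV(ℝⁿ)`, `u = 0` a.e. outside `Ω`, `u` takes a.e. values in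
`ℕ = {0, 1, 2, …}`, and `∫_Ω u = m`. -/
structure IsAdmissible {n : ℕ} (Ω : Set (EuclideanSpace ℝ (Fin n))) (m : ℝ)
    (u : EuclideanSpace ℝ (Fin n) → ℝ) : Prop where
  isBV : IsBV u
  eq_zero : ∀ᵐ x, x ∉ Ω → u x = 0
  integer_valued : ∀ᵐ x, ∃ k : ℕ, u x = k
  mass : ∫ x in Ω, u x = m

/-- `u` minimizes `∫_Ω φ*(Du)` among all competitors of mass `m`. -/
def IsMinimizer {n : ℕ} (φ : Seminorm ℝ (EuclideanSpace ℝ (Fin n)))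
    (Ω : Set (EuclideanSpace ℝ (Fin n))) (m : ℝ) (u : EuclideanSpace ℝ (Fin n) → ℝ) : Prop :=
  IsAdmissible Ω m u ∧ ∀ v, IsAdmissible Ω m v → variation φ Ω u ≤ variation φ Ω v

end AnisoBV

end

/-!
Let `W` be the unit ball of `φ`, and suppose that the minimizer `u` is not essentially bounded. Cut
`u` at a high level `k`, so that `u = min u k + (u - k)₊`, and write `ε` for the mass of `(u - k)₊`
and `a` for the volume of `{u > k}`. As `u` has integer values and exceeds `k + 1` on a set of
positive measure, `a < ε`. If `ρ` and `r` are the radii with `|ρW| = a` and `|rW| = ε`, then `ρ < r`.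

* By the isoperimetric inequality every set no larger than `ρW` has a perimeter at least `n / ρ`
  times its volume, this being the ratio for `ρW` itself. Summing over the superlevel sets of `u`
  above `k`, the cut lowers the variation by at least `(n / ρ) ε`
  (`ofReal_integral_min_mul_divergence_add_le`).
* Adding to `min u k` the indicator of a translate of `rW` inside `Ω` restores the mass, keeps the
  values integer, and costs at most the perimeter `(n / r) ε` of `rW`
  (`setIntegral_closedBall_divergence_le`). For small `ε` such a translate exists.

As `n / r < n / ρ`, the result is a better competitor (`exists_isAdmissible_variation_lt`).

The variation is accessible through test fields only, so the first point is proved for smooth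
functions and passes to the limit. For smooth `f` the variation is the integral of the dual norm of
the derivative (`integral_dualNorm_le`), and the isoperimetric inequality above a level of `f` comes
from the Brunn–Minkowski inequality for the sets `{f > s} + tW`, integrated over `s` and
differentiated at `t = 0` (`mul_lintegral_min_le`). The Brunn–Minkowski inequality is derived from
the Prékopa–Leindler inequality, which is proved by induction on the dimension. No coarea formula
for functions of bounded variation is needed: truncation of a smooth function is handled by
integration by parts for Lipschitz functions, and `u` is the almost everywhere limit of smooth
functions with no larger variation in the limit (`exists_smooth_approximation`).
-/

noncomputable section

namespace AnisoBV

open Filter Topology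
open scoped Pointwise

/-! ### The Prékopa–Leindler inequality -/

/-- On the line, two compact sets `K` and `L` have translates inside `K + L` that share at most one
point. -/
lemma volume_add_le_of_isCompact {K L C : Set ℝ} (hK : IsCompact K) (hL : IsCompact L)
    (hKn : K.Nonempty) (hLn : L.Nonempty) (h : ∀ a ∈ K, ∀ b ∈ L, a + b ∈ C) :
    volume K + volume L ≤ volume C := by
  have ha := hK.sSup_mem hKn
  have hb := hL.sInf_mem hLn
  set a := sSup K
  set b := sInf L
  have hsub : ((fun x => x - b) ⁻¹' K) ∪ ((fun x => x - a) ⁻¹' L) ⊆ C := by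
    rintro x (hx | hx)
    · simpa using h _ hx _ hb
    · simpa using h _ ha _ hx
  have hint : ((fun x => x - b) ⁻¹' K) ∩ ((fun x => x - a) ⁻¹' L) ⊆ {a + b} := by
    rintro x ⟨hx, hy⟩
    have h1 := le_csSup hK.bddAbove hx
    have h2 := csInf_le hL.bddBelow hy
    simp only [Set.mem_singleton_iff]
    have h3 : x - b ≤ a := h1
    have h4 : b ≤ x - a := h2
    linarith
  have h0 : volume (((fun x => x - b) ⁻¹' K) ∩ ((fun x => x - a) ⁻¹' L)) = 0 :=
    measure_mono_null hint (by simp)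
  have hm : MeasurableSet ((fun x => x - a) ⁻¹' L) :=
    (measurable_id.sub_const a) hL.measurableSet
  have hu := measure_union_add_inter (μ := volume) ((fun x => x - b) ⁻¹' K) hm
  simp only [sub_eq_add_neg, measure_preimage_add_right] at h0 hu hsub
  rw [h0, add_zero] at hu
  rw [← hu]
  exact measure_mono hsub

/-- The one-dimensional Brunn–Minkowski inequality. The sum set need not be measurable, so it is
replaced by any set `C` that contains it. -/
lemma volume_add_le_of_add_mem {A B C : Set ℝ} (hA : MeasurableSet A) (hB : MeasurableSet B)
    (hAn : A.Nonempty) (hBn : B.Nonempty) (h : ∀ a ∈ A, ∀ b ∈ B, a + b ∈ C) :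
    volume A + volume B ≤ volume C := by
  obtain ⟨a, ha⟩ := hAn
  obtain ⟨b, hb⟩ := hBn
  by_contra! hlt
  obtain ⟨K, L, hK, hL, hKc, hLc, hKn, hLn, hKL⟩ : ∃ K L : Set ℝ, K ⊆ A ∧ L ⊆ B ∧ IsCompact K ∧
      IsCompact L ∧ K.Nonempty ∧ L.Nonempty ∧ volume C < volume K + volume L := by
    rcases eq_or_ne (volume A) 0 with hA0 | hA0
    · rw [hA0, zero_add] at hlt
      obtain ⟨L, hL, hLc, hlt⟩ := hB.exists_lt_isCompact hlt
      refine ⟨{a}, L, by simpa, hL, isCompact_singleton, hLc, ⟨a, rfl⟩, ?_, by simpa⟩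
      by_contra! hne
      simp [hne] at hlt
    rcases eq_or_ne (volume B) 0 with hB0 | hB0
    · rw [hB0, add_zero] at hlt
      obtain ⟨K, hK, hKc, hlt⟩ := hA.exists_lt_isCompact hlt
      refine ⟨K, {b}, hK, by simpa, hKc, isCompact_singleton, ?_, ⟨b, rfl⟩, by simpa⟩
      by_contra! hne
      simp [hne] at hlt
    obtain ⟨y, hy, z, hz, hyz⟩ := ENNReal.exists_lt_add_of_lt_add hlt hA0 hB0
    obtain ⟨K, hK, hKc, hK'⟩ := hA.exists_lt_isCompact hy
    obtain ⟨L, hL, hLc, hL'⟩ := hB.exists_lt_isCompact hz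
    refine ⟨K, L, hK, hL, hKc, hLc, ?_, ?_, hyz.trans (ENNReal.add_lt_add hK' hL')⟩
    · by_contra! hne
      simp [hne] at hK'
    · by_contra! hne
      simp [hne] at hL'
  exact hKL.not_ge (volume_add_le_of_isCompact hKc hLc hKn hLn
    fun x hx y hy => h x (hK hx) y (hL hy))

lemma volume_smul_real (p : ℝ) (hp : 0 < p) (A : Set ℝ) :
    volume (p • A) = ENNReal.ofReal p * volume A := by
  rw [Measure.addHaar_smul]
  simp [abs_of_pos hp]

/-- The one-dimensional Prékopa–Leindler inequality for functions of supremum one: there the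
superlevel sets are nonempty for the same levels, so the one-dimensional Brunn–Minkowski inequality
can be integrated over the levels, and the arithmetic mean appears on the left. -/
lemma lintegral_add_le_of_iSup_eq_one {p q : ℝ} (hp : 0 < p) (hq : 0 < q) {f g h : ℝ → ℝ}
    (hf : Measurable f) (hg : Measurable g) (hh : Measurable h)
    (hf0 : ∀ x, 0 ≤ f x) (hg0 : ∀ x, 0 ≤ g x) (hh0 : ∀ x, 0 ≤ h x)
    (hf1 : ∀ x, f x ≤ 1) (hg1 : ∀ x, g x ≤ 1)
    (hfs : ∀ s < 1, ∃ x, s < f x) (hgs : ∀ s < 1, ∃ x, s < g x)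
    (hpq : p + q = 1) (H : ∀ x y, f x ^ p * g y ^ q ≤ h (p * x + q * y)) :
    ENNReal.ofReal p * (∫⁻ x, ENNReal.ofReal (f x)) + ENNReal.ofReal q * (∫⁻ x, ENNReal.ofReal (g x))
      ≤ ∫⁻ x, ENNReal.ofReal (h x) := by
  have key : ∀ t ∈ Set.Ioi (0 : ℝ),
      ENNReal.ofReal p * volume {x | t < f x} + ENNReal.ofReal q * volume {x | t < g x}
        ≤ volume {x | t < h x} := by
    intro t ht
    have ht : 0 < t := ht
    rcases lt_or_ge t 1 with ht1 | ht1
    · rw [← volume_smul_real p hp, ← volume_smul_real q hq]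
      refine volume_add_le_of_add_mem ((measurableSet_lt measurable_const hf).const_smul₀ p)
        ((measurableSet_lt measurable_const hg).const_smul₀ q)
        (Set.Nonempty.smul_set (hfs t ht1)) (Set.Nonempty.smul_set (hgs t ht1)) ?_
      rintro _ ⟨x, hx, rfl⟩ _ ⟨y, hy, rfl⟩
      refine lt_of_lt_of_le ?_ (H x y)
      have hx : t < f x := hx
      have hy : t < g y := hy
      calc t = t ^ p * t ^ q := by rw [← Real.rpow_add ht, hpq, Real.rpow_one]
        _ < f x ^ p * g y ^ q := by
          have h1 := Real.rpow_lt_rpow ht.le hx hp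
          have h2 := Real.rpow_lt_rpow ht.le hy hq
          exact mul_lt_mul'' h1 h2 (Real.rpow_nonneg ht.le _) (Real.rpow_nonneg ht.le _)
    · have h1 : {x | t < f x} = ∅ := by
        ext x; simpa using (hf1 x).trans ht1
      have h2 : {x | t < g x} = ∅ := by
        ext x; simpa using (hg1 x).trans ht1
      simp [h1, h2]
  rw [lintegral_eq_lintegral_meas_lt volume (.of_forall hf0) hf.aemeasurable,
    lintegral_eq_lintegral_meas_lt volume (.of_forall hg0) hg.aemeasurable,
    lintegral_eq_lintegral_meas_lt volume (.of_forall hh0) hh.aemeasurable,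
    ← lintegral_const_mul' _ _ (by simp), ← lintegral_const_mul' _ _ (by simp),
    ← lintegral_add_left']
  · exact setLIntegral_mono' measurableSet_Ioi key
  · apply Measurable.aemeasurable
    apply Measurable.const_mul
    have : Antitone fun t : ℝ => volume {x | t < f x} := fun s t hst =>
      measure_mono fun x (hx : t < f x) => lt_of_le_of_lt hst hx
    exact this.measurable

lemma ennreal_geom_mean_le_arith_mean {p q : ℝ} (hp : 0 < p) (hq : 0 < q)
    (hpq : p + q = 1) (a b : ℝ≥0∞) :
    a ^ p * b ^ q ≤ ENNReal.ofReal p * a + ENNReal.ofReal q * b := by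
  have h := ENNReal.young_inequality (a ^ p) (b ^ q) (p := p⁻¹) (q := q⁻¹)
    ⟨by simpa using hpq, by positivity, by positivity⟩
  rwa [← ENNReal.rpow_mul, ← ENNReal.rpow_mul, mul_inv_cancel₀ hp.ne', mul_inv_cancel₀ hq.ne',
    ENNReal.rpow_one, ENNReal.rpow_one, ENNReal.ofReal_inv_of_pos hp, ENNReal.ofReal_inv_of_pos hq,
    div_eq_mul_inv, div_eq_mul_inv, inv_inv, inv_inv, mul_comm a, mul_comm b] at h

/-- The Prékopa–Leindler inequality on the line for bounded functions. -/
lemma prekopa_leindler_real_of_iSup_lt_top {p q : ℝ} (hp : 0 < p) (hq : 0 < q) (hpq : p + q = 1)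
    {f g h : ℝ → ℝ≥0∞} (hf : Measurable f) (hg : Measurable g) (hh : Measurable h)
    (hfM : ⨆ x, f x < ∞) (hgM : ⨆ x, g x < ∞)
    (H : ∀ x y, f x ^ p * g y ^ q ≤ h (p * x + q * y)) :
    (∫⁻ x, f x) ^ p * (∫⁻ x, g x) ^ q ≤ ∫⁻ x, h x := by
  rcases eq_or_ne (⨆ x, f x) 0 with hf0 | hf0
  · have : ∀ x, f x = 0 := by simpa using hf0
    simp [this, hp]
  rcases eq_or_ne (⨆ x, g x) 0 with hg0 | hg0
  · have : ∀ x, g x = 0 := by simpa using hg0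
    simp [this, hq]
  have hle : ∀ x, f x ≤ ⨆ x, f x := le_iSup f
  have hle' : ∀ x, g x ≤ ⨆ x, g x := le_iSup g
  have hex : ∀ s < ⨆ x, f x, ∃ x, s < f x := fun s hs => lt_iSup_iff.1 hs
  have hex' : ∀ s < ⨆ x, g x, ∃ x, s < g x := fun s hs => lt_iSup_iff.1 hs
  generalize (⨆ x, f x) = M at *
  generalize (⨆ x, g x) = N at *
  have hd : ∀ {F : ℝ → ℝ≥0∞} {M : ℝ≥0∞}, M ≠ 0 → M < ∞ → (∀ x, F x ≤ M) → ∀ x, F x / M ≤ 1 := by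
    intro F M _ _ hF x
    exact ENNReal.div_le_of_le_mul (by simpa using hF x)
  have hd' : ∀ {F : ℝ → ℝ≥0∞} {M : ℝ≥0∞}, M ≠ 0 → M < ∞ → (∀ x, F x ≤ M) →
      (∀ s < M, ∃ x, s < F x) → ∀ s < (1 : ℝ), ∃ x, s < (F x / M).toReal := by
    intro F M h0 h1 hF hs s hs1
    rcases lt_or_ge s 0 with hs0 | hs0
    · exact ⟨0, hs0.trans_le ENNReal.toReal_nonneg⟩
    obtain ⟨x, hx⟩ := hs (ENNReal.ofReal s * M) (by
      calc ENNReal.ofReal s * M < 1 * M :=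
            ENNReal.mul_lt_mul_left h0 h1.ne (by simpa using hs1)
        _ = M := one_mul M)
    refine ⟨x, ?_⟩
    rw [← ENNReal.ofReal_lt_iff_lt_toReal hs0 (ne_top_of_le_ne_top ENNReal.one_ne_top (hd h0 h1 hF x))]
    rwa [ENNReal.lt_div_iff_mul_lt (.inl h0) (.inl h1.ne)]
  have hP0 : M ^ p * N ^ q ≠ 0 := mul_ne_zero (by simp [hf0, hfM.ne]) (by simp [hg0, hgM.ne])
  have hPt : M ^ p * N ^ q ≠ ∞ := ENNReal.mul_ne_top (ENNReal.rpow_ne_top_of_nonneg hp.le hfM.ne)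
      (ENNReal.rpow_ne_top_of_nonneg hq.le hgM.ne)
  have hk := lintegral_add_le_of_iSup_eq_one hp hq (f := fun x => (f x / M).toReal)
    (g := fun x => (g x / N).toReal) (h := fun x => (min (h x / (M ^ p * N ^ q)) 1).toReal)
    (hf.div_const M).ennreal_toReal (hg.div_const N).ennreal_toReal
    ((hh.div_const _).min measurable_const).ennreal_toReal
    (fun _ => ENNReal.toReal_nonneg) (fun _ => ENNReal.toReal_nonneg)
    (fun _ => ENNReal.toReal_nonneg)
    (fun x => ENNReal.toReal_le_of_le_ofReal zero_le_one (by simpa using hd hf0 hfM hle x))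
    (fun x => ENNReal.toReal_le_of_le_ofReal zero_le_one (by simpa using hd hg0 hgM hle' x))
    (hd' hf0 hfM hle hex) (hd' hg0 hgM hle' hex') hpq (by
      intro x y
      rw [ENNReal.toReal_rpow, ENNReal.toReal_rpow, ← ENNReal.toReal_mul]
      refine ENNReal.toReal_mono (ne_top_of_le_ne_top ENNReal.one_ne_top (min_le_right _ _))
        (le_min ?_ ?_)
      · rw [ENNReal.div_rpow_of_nonneg _ _ hp.le, ENNReal.div_rpow_of_nonneg _ _ hq.le,
          ENNReal.div_eq_inv_mul, ENNReal.div_eq_inv_mul, ENNReal.div_eq_inv_mul,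
          ENNReal.mul_inv (.inr (ENNReal.rpow_ne_top_of_nonneg hq.le hgM.ne))
            (.inl (ENNReal.rpow_ne_top_of_nonneg hp.le hfM.ne)), mul_mul_mul_comm]
        gcongr
        exact H x y
      · exact mul_le_one' (ENNReal.rpow_le_one (hd hf0 hfM hle x) hp.le)
          (ENNReal.rpow_le_one (hd hg0 hgM hle' y) hq.le))
  have e1 : ∀ x, ENNReal.ofReal (f x / M).toReal = M⁻¹ * f x := fun x => by
    rw [ENNReal.ofReal_toReal (ne_top_of_le_ne_top ENNReal.one_ne_top (hd hf0 hfM hle x)),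
      ENNReal.div_eq_inv_mul]
  have e2 : ∀ x, ENNReal.ofReal (g x / N).toReal = N⁻¹ * g x := fun x => by
    rw [ENNReal.ofReal_toReal (ne_top_of_le_ne_top ENNReal.one_ne_top (hd hg0 hgM hle' x)),
      ENNReal.div_eq_inv_mul]
  have e3 : ∀ x, ENNReal.ofReal (min (h x / (M ^ p * N ^ q)) 1).toReal ≤ (M ^ p * N ^ q)⁻¹ * h x :=
    fun x => by
      rw [ENNReal.ofReal_toReal (ne_top_of_le_ne_top ENNReal.one_ne_top (min_le_right _ _)),
        ENNReal.div_eq_inv_mul]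
      exact min_le_left _ _
  simp only [e1, e2] at hk
  have hk2 := ((ennreal_geom_mean_le_arith_mean hp hq hpq _ _).trans hk).trans
    (lintegral_mono e3)
  rw [lintegral_const_mul _ hf, lintegral_const_mul _ hg, lintegral_const_mul _ hh,
    ENNReal.mul_rpow_of_nonneg _ _ hp.le, ENNReal.mul_rpow_of_nonneg _ _ hq.le,
    mul_mul_mul_comm, ENNReal.inv_rpow, ENNReal.inv_rpow,
    ← ENNReal.mul_inv (.inr (ENNReal.rpow_ne_top_of_nonneg hq.le hgM.ne))
            (.inl (ENNReal.rpow_ne_top_of_nonneg hp.le hfM.ne))] at hk2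
  rwa [ENNReal.mul_le_mul_iff_right (by simpa using hPt) (by simpa using hP0)] at hk2

lemma tendsto_lintegral_min_natCast {f : ℝ → ℝ≥0∞} (hf : Measurable f) :
    Filter.Tendsto (fun N : ℕ => ∫⁻ x, min (f x) N) .atTop (nhds (∫⁻ x, f x)) := by
  refine lintegral_tendsto_of_tendsto_of_monotone
    (fun N => (hf.min measurable_const).aemeasurable) (.of_forall fun x M N hMN => ?_)
    (.of_forall fun x => ?_)
  · dsimp only
    gcongr
  · have : Filter.Tendsto (fun N : ℕ => min (f x) (N : ℝ≥0∞)) .atTop (nhds (min (f x) ∞)) :=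
      tendsto_const_nhds.min ENNReal.tendsto_nat_nhds_top
    simpa using this

/-- The Prékopa–Leindler inequality on the line, by truncation of `f` and `g`. -/
lemma prekopa_leindler_real {p q : ℝ} (hp : 0 < p) (hq : 0 < q) (hpq : p + q = 1)
    {f g h : ℝ → ℝ≥0∞} (hf : Measurable f) (hg : Measurable g) (hh : Measurable h)
    (H : ∀ x y, f x ^ p * g y ^ q ≤ h (p * x + q * y)) :
    (∫⁻ x, f x) ^ p * (∫⁻ x, g x) ^ q ≤ ∫⁻ x, h x := by
  rcases eq_or_ne (∫⁻ x, f x) 0 with hf0 | hf0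
  · simp [hf0, hp]
  rcases eq_or_ne (∫⁻ x, g x) 0 with hg0 | hg0
  · simp [hg0, hq]
  have t1 := ((ENNReal.continuous_rpow_const (y := p)).tendsto _).comp
    (tendsto_lintegral_min_natCast hf)
  have t2 := ((ENNReal.continuous_rpow_const (y := q)).tendsto _).comp
    (tendsto_lintegral_min_natCast hg)
  refine le_of_tendsto (ENNReal.Tendsto.mul t1 (.inl ?_) t2 (.inl ?_)) (.of_forall fun N => ?_)
  · simp [hf0, hp.not_gt]
  · simp [hg0, hq.not_gt]
  refine prekopa_leindler_real_of_iSup_lt_top hp hq hpq (hf.min measurable_const)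
    (hg.min measurable_const) hh ?_ ?_ fun x y => le_trans ?_ (H x y)
  · exact (iSup_le fun x => min_le_right _ _).trans_lt (ENNReal.natCast_lt_top N)
  · exact (iSup_le fun x => min_le_right _ _).trans_lt (ENNReal.natCast_lt_top N)
  · gcongr
    · exact min_le_left _ _
    · exact min_le_left _ _

/-- The Prékopa–Leindler inequality in coordinates. In the induction step the integrals over the
slices satisfy the hypothesis of the one-dimensional inequality. -/
lemma prekopa_leindler_pi {p q : ℝ} (hp : 0 < p) (hq : 0 < q) (hpq : p + q = 1) (n : ℕ) :
    ∀ {f g h : (Fin n → ℝ) → ℝ≥0∞}, Measurable f → Measurable g → Measurable h →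
    (∀ x y, f x ^ p * g y ^ q ≤ h (p • x + q • y)) →
    (∫⁻ x, f x) ^ p * (∫⁻ x, g x) ^ q ≤ ∫⁻ x, h x := by
  induction n with
  | zero =>
    intro f g h _ _ _ H
    have hv : volume (Set.univ : Set (Fin 0 → ℝ)) = 1 := by
      rw [volume_pi, Measure.pi_of_empty _ default]
      simp
    simp only [lintegral_unique, hv, mul_one]
    have h0 : ∀ x : Fin 0 → ℝ, x = Unique.instInhabited.default := fun x => Subsingleton.elim _ _
    exact (H _ _).trans_eq (congrArg h (h0 _))
  | succ n ih =>
    intro f g h hf hg hh H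
    set e := (MeasurableEquiv.piFinSuccAbove (fun _ : Fin (n + 1) => ℝ) 0).symm with he
    have hmp : MeasurePreserving e volume volume :=
      (volume_preserving_piFinSuccAbove (fun _ : Fin (n + 1) => ℝ) 0).symm _
    have hint : ∀ {F : (Fin (n + 1) → ℝ) → ℝ≥0∞}, Measurable F →
        ∫⁻ x, F x = ∫⁻ s : ℝ, ∫⁻ y : Fin n → ℝ, F (e (s, y)) := by
      intro F hF
      rw [← hmp.lintegral_comp hF]
      exact lintegral_prod _ (hF.comp e.measurable).aemeasurable
    rw [hint hf, hint hg, hint hh]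
    refine prekopa_leindler_real hp hq hpq (hf.comp e.measurable).lintegral_prod_right'
      (hg.comp e.measurable).lintegral_prod_right' (hh.comp e.measurable).lintegral_prod_right' ?_
    intro s t
    have hc : ∀ s : ℝ, Measurable fun y : Fin n → ℝ => e (s, y) := fun s =>
      e.measurable.comp measurable_prodMk_left
    refine ih (hf.comp (hc s)) (hg.comp (hc t)) (hh.comp (hc _)) fun x y => ?_
    refine (H _ _).trans (le_of_eq (congrArg h ?_))
    ext i
    refine Fin.cases ?_ (fun j => ?_) i <;>
      simp [he, MeasurableEquiv.piFinSuccAbove, Fin.insertNthEquiv]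

/-- The Prékopa–Leindler inequality. -/
theorem prekopa_leindler {n : ℕ} {p q : ℝ} (hp : 0 < p) (hq : 0 < q) (hpq : p + q = 1)
    {f g h : EuclideanSpace ℝ (Fin n) → ℝ≥0∞} (hf : Measurable f) (hg : Measurable g)
    (hh : Measurable h) (H : ∀ x y, f x ^ p * g y ^ q ≤ h (p • x + q • y)) :
    (∫⁻ x, f x) ^ p * (∫⁻ x, g x) ^ q ≤ ∫⁻ x, h x := by
  have hmp := (EuclideanSpace.volume_preserving_symm_measurableEquiv_toLp (Fin n)).symm
  rw [← hmp.lintegral_comp hf, ← hmp.lintegral_comp hg, ← hmp.lintegral_comp hh]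
  exact prekopa_leindler_pi hp hq hpq n (hf.comp (MeasurableEquiv.measurable _))
    (hg.comp (MeasurableEquiv.measurable _)) (hh.comp (MeasurableEquiv.measurable _))
    fun x y => H _ _

/-! ### The Brunn–Minkowski inequality -/

/-- The Brunn–Minkowski inequality `|A + B|^{1/n} ≥ |A|^{1/n} + |B|^{1/n}`, with `α` and `β` the
`n`-th roots of the volumes of `A` and `B`. -/
theorem brunn_minkowski {n : ℕ} {A B C : Set (EuclideanSpace ℝ (Fin n))} (hA : MeasurableSet A)
    (hB : MeasurableSet B) (hC : MeasurableSet C) (h : ∀ a ∈ A, ∀ b ∈ B, a + b ∈ C)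
    {α β : ℝ} (hα : 0 < α) (hβ : 0 < β) (hAα : volume A = ENNReal.ofReal (α ^ n))
    (hBβ : volume B = ENNReal.ofReal (β ^ n)) :
    ENNReal.ofReal ((α + β) ^ n) ≤ volume C := by
  have hs : 0 < α + β := by positivity
  have hunit : ∀ {r : ℝ} {S : Set (EuclideanSpace ℝ (Fin n))}, 0 < r →
      volume (r⁻¹ • S) = (ENNReal.ofReal (r ^ n))⁻¹ * volume S := by
    intro r S hr
    rw [Measure.addHaar_smul, finrank_euclideanSpace_fin, abs_of_pos (by positivity), inv_pow,
      ENNReal.ofReal_inv_of_pos (by positivity)]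
  have hne : ∀ {r : ℝ}, 0 < r → ENNReal.ofReal (r ^ n) ≠ 0 := fun hr => by
    simpa using pow_pos hr n
  have key := prekopa_leindler (n := n) (p := α / (α + β)) (q := β / (α + β)) (by positivity)
    (by positivity) (by field_simp)
    (f := (α⁻¹ • A).indicator 1) (g := (β⁻¹ • B).indicator 1) (h := ((α + β)⁻¹ • C).indicator 1)
    (measurable_one.indicator (hA.const_smul₀ _)) (measurable_one.indicator (hB.const_smul₀ _))
    (measurable_one.indicator (hC.const_smul₀ _)) (by
      intro x y
      by_cases hx : x ∈ α⁻¹ • A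
      · by_cases hy : y ∈ β⁻¹ • B
        · rw [Set.indicator_of_mem hx, Set.indicator_of_mem hy, Set.indicator_of_mem]
          · simp
          · obtain ⟨a, ha, rfl⟩ := hx
            obtain ⟨b, hb, rfl⟩ := hy
            refine ⟨a + b, h a ha b hb, ?_⟩
            simp only [smul_smul, smul_add]
            congr 2 <;> field_simp
        · rw [Set.indicator_of_notMem hy, ENNReal.zero_rpow_of_pos (by positivity), mul_zero]
          exact zero_le
      · rw [Set.indicator_of_notMem hx, ENNReal.zero_rpow_of_pos (by positivity), zero_mul]
        exact zero_le)
  rw [lintegral_indicator_one (hA.const_smul₀ _), lintegral_indicator_one (hB.const_smul₀ _),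
    lintegral_indicator_one (hC.const_smul₀ _), hunit hα, hunit hβ, hunit hs, hAα, hBβ,
    ENNReal.inv_mul_cancel (hne hα) (by simp), ENNReal.inv_mul_cancel (hne hβ) (by simp)] at key
  simp only [ENNReal.one_rpow, mul_one] at key
  rw [← ENNReal.div_eq_inv_mul, ENNReal.le_div_iff_mul_le (.inl (hne hs)) (.inl (by simp)),
    one_mul] at key
  exact key
/-- A quantitative form of the Brunn–Minkowski inequality, linear in `t`: the enlargement `A + tW`
gains at least `(n t / ρ) |A|` as long as `A` is no larger than `ρW`. -/
lemma add_mul_min_le_volume_of_add_smul_mem {n : ℕ} (hn : n ≠ 0)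
    {A W C : Set (EuclideanSpace ℝ (Fin n))} (hA : MeasurableSet A) (hW : MeasurableSet W)
    (hC : MeasurableSet C) {t ρ : ℝ} (ht : 0 < t) (hρ : 0 < ρ)
    (h : ∀ a ∈ A, ∀ w ∈ W, a + t • w ∈ C) (hAt : volume A ≠ ∞) (hW0 : volume W ≠ 0)
    (hWt : volume W ≠ ∞) :
    volume A + ENNReal.ofReal (n * t / ρ) * min (volume A) (ENNReal.ofReal (ρ ^ n) * volume W)
      ≤ volume C := by
  have root : ∀ {S : Set (EuclideanSpace ℝ (Fin n))}, volume S ≠ 0 → volume S ≠ ∞ →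
      ∃ r : ℝ, 0 < r ∧ volume S = ENNReal.ofReal (r ^ n) := by
    intro S h0 h1
    have hpos := ENNReal.toReal_pos h0 h1
    refine ⟨(volume S).toReal ^ (n : ℝ)⁻¹, Real.rpow_pos_of_pos hpos _, ?_⟩
    rw [Real.rpow_inv_natCast_pow hpos.le hn, ENNReal.ofReal_toReal h1]
  obtain ⟨w₀, hw₀⟩ : W.Nonempty := by
    by_contra! hne
    simp [hne] at hW0
  rcases eq_or_ne (volume A) 0 with hA0 | hA0
  · simp [hA0]
  obtain ⟨α, hα, hAα⟩ := root hA0 hAt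
  obtain ⟨ω, hω, hWω⟩ := root hW0 hWt
  have htW : volume (t • W) = ENNReal.ofReal ((t * ω) ^ n) := by
    rw [Measure.addHaar_smul, finrank_euclideanSpace_fin, abs_of_pos (by positivity), hWω,
      ← ENNReal.ofReal_mul (by positivity), mul_pow]
  refine le_trans ?_ (brunn_minkowski hA (hW.const_smul₀ t) hC ?_ hα (by positivity) hAα htW)
  · rw [hAα, hWω, ← ENNReal.ofReal_mul (by positivity), ← ENNReal.ofReal_min,
      ← ENNReal.ofReal_mul (by positivity), ← ENNReal.ofReal_add (by positivity) (by positivity)]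
    apply ENNReal.ofReal_le_ofReal
    obtain ⟨m, rfl⟩ := Nat.exists_eq_succ_of_ne_zero hn
    -- Bernoulli's inequality is the derivative of the `n`-th power here.
    have hb : α ^ (m + 1) + (m + 1 : ℕ) * α ^ m * (t * ω) ≤ (α + t * ω) ^ (m + 1) := by
      have h1 := one_add_mul_le_pow (a := t * ω / α) (by
        have : 0 < t * ω / α := by positivity
        linarith) (m + 1)
      have h2 := mul_le_mul_of_nonneg_left h1 (pow_pos hα (m + 1)).le
      rw [← mul_pow] at h2
      rw [show α * (1 + t * ω / α) = α + t * ω by field_simp] at h2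
      refine (Eq.trans_le ?_ h2)
      field_simp
      ring
    refine le_trans ?_ hb
    have hmin : min (α ^ (m + 1)) (ρ ^ (m + 1) * ω ^ (m + 1)) ≤ ρ * (α ^ m * ω) := by
      rcases le_total α (ρ * ω) with hle | hle
      · refine (min_le_left _ _).trans ?_
        calc α ^ (m + 1) = α ^ m * α := pow_succ _ _
          _ ≤ α ^ m * (ρ * ω) := by gcongr
          _ = _ := by ring
      · refine (min_le_right _ _).trans ?_
        calc ρ ^ (m + 1) * ω ^ (m + 1) = (ρ * ω) ^ m * (ρ * ω) := by ring
          _ ≤ α ^ m * (ρ * ω) := by gcongr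
          _ = _ := by ring
    have := mul_le_mul_of_nonneg_left hmin (show 0 ≤ ((m + 1 : ℕ) : ℝ) * t / ρ by positivity)
    simp only [Nat.succ_eq_add_one]
    refine add_le_add le_rfl (this.trans_eq ?_)
    field_simp
  · rintro a ha _ ⟨w, hw, rfl⟩
    exact h a ha w hw

variable {n : ℕ}

/-! ### Norms on `ℝⁿ` and their duals -/

lemma exists_seminorm_le_mul_norm (φ : Seminorm ℝ (EuclideanSpace ℝ (Fin n))) :
    ∃ C > 0, ∀ x, φ x ≤ C * ‖x‖ := by
  refine ⟨∑ i, φ (EuclideanSpace.single i 1) + 1, by positivity, fun x => ?_⟩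
  have hx : x = ∑ i, x i • EuclideanSpace.single i (1 : ℝ) := by
    simpa using ((EuclideanSpace.basisFun (Fin n) ℝ).sum_repr x).symm
  calc φ x = φ (∑ i, x i • EuclideanSpace.single i (1 : ℝ)) := by rw [← hx]
    _ ≤ ∑ i, φ (x i • EuclideanSpace.single i (1 : ℝ)) :=
        Finset.le_sum_of_subadditive φ (map_zero φ).le (map_add_le_add φ) _ _
    _ ≤ ∑ i, ‖x‖ * φ (EuclideanSpace.single i (1 : ℝ)) := by
        refine Finset.sum_le_sum fun i _ => ?_
        rw [map_smul_eq_mul]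
        have := PiLp.norm_apply_le x i
        gcongr
    _ = (∑ i, φ (EuclideanSpace.single i 1)) * ‖x‖ := by rw [← Finset.mul_sum, mul_comm]
    _ ≤ _ := by
        gcongr
        linarith

lemma continuous_seminorm (φ : Seminorm ℝ (EuclideanSpace ℝ (Fin n))) : Continuous φ := by
  obtain ⟨C, hC, h⟩ := exists_seminorm_le_mul_norm φ
  refine (LipschitzWith.of_dist_le_mul (K := ⟨C, hC.le⟩) fun x y => ?_).continuous
  rw [Real.dist_eq, dist_eq_norm]
  exact (abs_sub_map_le_sub φ x y).trans (h _)

lemma exists_norm_le_mul_seminorm {φ : Seminorm ℝ (EuclideanSpace ℝ (Fin n))}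
    (hφ : ∀ x, φ x = 0 → x = 0) : ∃ c > 0, ∀ x, ‖x‖ ≤ c * φ x := by
  rcases (Metric.sphere (0 : EuclideanSpace ℝ (Fin n)) 1).eq_empty_or_nonempty with he | hne
  · refine ⟨1, one_pos, fun x => ?_⟩
    have : x = 0 := by
      by_contra hx
      have : ‖x‖⁻¹ • x ∈ Metric.sphere (0 : EuclideanSpace ℝ (Fin n)) 1 := by
        simp [norm_smul, hx]
      simp [he] at this
    simp [this]
  obtain ⟨z, hz, hmin⟩ := (isCompact_sphere (0 : EuclideanSpace ℝ (Fin n)) 1).exists_isMinOn hne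
    (continuous_seminorm φ).continuousOn
  have hz0 : 0 < φ z := lt_of_le_of_ne (apply_nonneg φ z) fun h0 => by
    have := hφ z h0.symm
    simp [this] at hz
  refine ⟨(φ z)⁻¹, by positivity, fun x => ?_⟩
  rcases eq_or_ne x 0 with rfl | hx
  · simp
  have hx' : 0 < ‖x‖ := norm_pos_iff.2 hx
  have h1 : φ z ≤ φ (‖x‖⁻¹ • x) := hmin (by simp [norm_smul, hx])
  rw [map_smul_eq_mul, norm_inv, norm_norm, ← div_eq_inv_mul, le_div_iff₀ hx'] at h1
  rwa [← div_eq_inv_mul, le_div_iff₀ hz0, mul_comm]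

lemma isCompact_closedBall_seminorm {φ : Seminorm ℝ (EuclideanSpace ℝ (Fin n))}
    (hφ : ∀ x, φ x = 0 → x = 0) (x : EuclideanSpace ℝ (Fin n)) (r : ℝ) :
    IsCompact (φ.closedBall x r) := by
  obtain ⟨c, hc, h⟩ := exists_norm_le_mul_seminorm hφ
  refine (isCompact_closedBall x (c * r)).of_isClosed_subset ?_ fun y hy => ?_
  · exact isClosed_le ((continuous_seminorm φ).comp (continuous_id.sub continuous_const))
      continuous_const
  · rw [Seminorm.mem_closedBall] at hy
    rw [mem_closedBall_iff_norm]
    exact (h _).trans (by gcongr)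

lemma volume_closedBall_seminorm_pos (φ : Seminorm ℝ (EuclideanSpace ℝ (Fin n))) :
    0 < volume (φ.closedBall 0 1) := by
  have ho : IsOpen {x | φ x < 1} := isOpen_lt (continuous_seminorm φ) continuous_const
  refine (ho.measure_pos volume ⟨0, by simp⟩).trans_le (measure_mono fun x hx => ?_)
  rw [Seminorm.mem_closedBall_zero]
  exact le_of_lt hx

/-- The norm dual to `φ`, on linear functionals. -/
def dualNorm (φ : Seminorm ℝ (EuclideanSpace ℝ (Fin n))) (l : EuclideanSpace ℝ (Fin n) →L[ℝ] ℝ) :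
    ℝ :=
  sSup (l '' φ.closedBall 0 1)

section dualNorm

variable {φ : Seminorm ℝ (EuclideanSpace ℝ (Fin n))} (hφ : ∀ x, φ x = 0 → x = 0)
include hφ

lemma le_dualNorm (l : EuclideanSpace ℝ (Fin n) →L[ℝ] ℝ) {y : EuclideanSpace ℝ (Fin n)}
    (hy : φ y ≤ 1) : l y ≤ dualNorm φ l :=
  le_csSup ((isCompact_closedBall_seminorm hφ 0 1).image l.continuous).bddAbove
    ⟨y, by simpa [Seminorm.mem_closedBall_zero] using hy, rfl⟩

lemma dualNorm_nonneg (l : EuclideanSpace ℝ (Fin n) →L[ℝ] ℝ) : 0 ≤ dualNorm φ l := by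
  simpa using le_dualNorm hφ l (y := 0) (by simp)

lemma exists_eq_dualNorm (l : EuclideanSpace ℝ (Fin n) →L[ℝ] ℝ) :
    ∃ y, φ y ≤ 1 ∧ l y = dualNorm φ l := by
  obtain ⟨y, hy, h⟩ := ((isCompact_closedBall_seminorm hφ 0 1).image l.continuous).sSup_mem
    ⟨_, 0, by simp, rfl⟩
  exact ⟨y, by simpa [Seminorm.mem_closedBall_zero] using hy, h⟩

lemma continuous_dualNorm : Continuous (dualNorm φ) :=
  (isCompact_closedBall_seminorm hφ 0 1).continuous_sSup
    (f := fun (l : EuclideanSpace ℝ (Fin n) →L[ℝ] ℝ) y => l y)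
    (isBoundedBilinearMap_apply.continuous)

omit hφ in
lemma dualNorm_zero : dualNorm φ 0 = 0 := by
  have : (⇑(0 : EuclideanSpace ℝ (Fin n) →L[ℝ] ℝ)) '' φ.closedBall 0 1 = {0} := by
    ext x
    constructor
    · rintro ⟨y, -, rfl⟩
      simp
    · rintro rfl
      exact ⟨0, by simp, rfl⟩
  rw [dualNorm, this, csSup_singleton]

lemma continuous_dualNorm_fderiv {f : EuclideanSpace ℝ (Fin n) → ℝ} (hf : ContDiff ℝ 1 f) :
    Continuous fun x => dualNorm φ (fderiv ℝ f x) :=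
  (continuous_dualNorm hφ).comp (hf.continuous_fderiv (by norm_num))

lemma integrable_dualNorm_fderiv {f : EuclideanSpace ℝ (Fin n) → ℝ} (hf : ContDiff ℝ 1 f)
    (hfc : HasCompactSupport f) : Integrable fun x => dualNorm φ (fderiv ℝ f x) :=
  (continuous_dualNorm_fderiv hφ hf).integrable_of_hasCompactSupport
    ((hfc.fderiv (𝕜 := ℝ)).comp_left dualNorm_zero)

end dualNorm

/-! ### Integration by parts against a vector field -/

section parts

variable {η : EuclideanSpace ℝ (Fin n) → EuclideanSpace ℝ (Fin n)}

lemma hasFDerivAt_coord (h1 : ContDiff ℝ 1 η) (i : Fin n) (x : EuclideanSpace ℝ (Fin n)) :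
    HasFDerivAt (fun x => η x i)
      ((EuclideanSpace.proj i : EuclideanSpace ℝ (Fin n) →L[ℝ] ℝ).comp (fderiv ℝ η x)) x :=
  (EuclideanSpace.proj i : EuclideanSpace ℝ (Fin n) →L[ℝ] ℝ).hasFDerivAt.comp x
    ((h1.differentiable (by norm_num)) x).hasFDerivAt

lemma continuous_divergence (h1 : ContDiff ℝ 1 η) : Continuous (divergence η) := by
  unfold divergence
  refine continuous_finsetSum _ fun i _ => ?_
  exact (EuclideanSpace.proj i : EuclideanSpace ℝ (Fin n) →L[ℝ] ℝ).continuous.comp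
    ((h1.continuous_fderiv (by norm_num)).clm_apply continuous_const)

lemma hasCompactSupport_divergence (h2 : HasCompactSupport η) :
    HasCompactSupport (divergence η) := by
  have := (h2.fderiv (𝕜 := ℝ)).comp_left
    (g := fun L : EuclideanSpace ℝ (Fin n) →L[ℝ] EuclideanSpace ℝ (Fin n) =>
      ∑ i, (L (EuclideanSpace.single i 1)) i) (by simp)
  exact this

/-- Integration by parts for a Lipschitz function and a compactly supported `C¹` field. The
derivative exists almost everywhere by Rademacher's theorem. -/
lemma integral_mul_divergence {g : EuclideanSpace ℝ (Fin n) → ℝ} {C : NNReal}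
    (hg : LipschitzWith C g) (h1 : ContDiff ℝ 1 η) (h2 : HasCompactSupport η) :
    ∫ x, g x * divergence η x = -∫ x, fderiv ℝ g x (η x) := by
  set e : Fin n → EuclideanSpace ℝ (Fin n) := fun i => EuclideanSpace.single i 1 with he
  have hη1 : ∀ i, ContDiff ℝ 1 fun x => η x i := fun i =>
    (EuclideanSpace.proj i : EuclideanSpace ℝ (Fin n) →L[ℝ] ℝ).contDiff.comp h1
  have hη2 : ∀ i, HasCompactSupport fun x => η x i := fun i =>
    h2.comp_left (g := fun v : EuclideanSpace ℝ (Fin n) => v i) (by simp)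
  have hd : ∀ i x, fderiv ℝ η x (e i) i = fderiv ℝ (fun x => η x i) x (e i) := fun i x => by
    rw [(hasFDerivAt_coord h1 i x).fderiv]
    rfl
  have hint1 : ∀ i, Integrable fun x => g x * fderiv ℝ (fun x => η x i) x (e i) := fun i =>
    (hg.continuous.mul (((hη1 i).continuous_fderiv (by norm_num)).clm_apply
      continuous_const)).integrable_of_hasCompactSupport
      (((hη2 i).fderiv_apply (𝕜 := ℝ) (e i)).mul_left)
  have hint2 : ∀ i, Integrable fun x => lineDeriv ℝ g x (e i) * η x i := fun i =>
    ((hη1 i).continuous.integrable_of_hasCompactSupport (hη2 i)).bdd_mul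
      (hg.memLp_lineDeriv (e i)).aestronglyMeasurable
      (.of_forall fun x => norm_lineDeriv_le_of_lipschitz ℝ hg)
  have hparts : ∀ i, ∫ x, g x * fderiv ℝ (fun x => η x i) x (e i)
      = -∫ x, lineDeriv ℝ g x (e i) * η x i := by
    intro i
    obtain ⟨D, hD⟩ := ContDiff.lipschitzWith_of_hasCompactSupport (hη2 i) (hη1 i) (by norm_num)
    rw [hg.integral_lineDeriv_mul_eq hD (hη2 i), ← integral_neg]
    congr 1
    ext x
    rw [((hη1 i).differentiable (by norm_num) x).lineDeriv_eq_fderiv, map_neg]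
    ring
  calc ∫ x, g x * divergence η x
      = ∫ x, ∑ i, g x * fderiv ℝ (fun x => η x i) x (e i) := by
        simp only [divergence, Finset.mul_sum, ← hd]
        rfl
    _ = -∫ x, ∑ i, lineDeriv ℝ g x (e i) * η x i := by
        rw [integral_finsetSum _ fun i _ => hint1 i, integral_finsetSum _ fun i _ => hint2 i,
          ← Finset.sum_neg_distrib]
        exact Finset.sum_congr rfl fun i _ => hparts i
    _ = -∫ x, fderiv ℝ g x (η x) := by
        congr 1
        refine integral_congr_ae ?_
        filter_upwards [hg.ae_differentiableAt] with x hx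
        have hx' : η x = ∑ i, η x i • e i := by
          simpa [he] using ((EuclideanSpace.basisFun (Fin n) ℝ).sum_repr (η x)).symm
        conv_rhs => rw [hx', map_sum]
        refine Finset.sum_congr rfl fun i _ => ?_
        rw [hx.lineDeriv_eq_fderiv, map_smul, smul_eq_mul, mul_comm]

end parts

variable {φ : Seminorm ℝ (EuclideanSpace ℝ (Fin n))}
  {η : EuclideanSpace ℝ (Fin n) → EuclideanSpace ℝ (Fin n)}

lemma neg_fderiv_le_dualNorm (hφ : ∀ x, φ x = 0 → x = 0) (hη : IsTestField φ η)
    (g : EuclideanSpace ℝ (Fin n) → ℝ) (x : EuclideanSpace ℝ (Fin n)) :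
    -(fderiv ℝ g x (η x)) ≤ dualNorm φ (fderiv ℝ g x) := by
  rw [← map_neg]
  exact le_dualNorm hφ _ (by simpa using hη.2.2 x)

/-- Truncating `f` at height `k` removes the variation of `f` on `{f ≥ k}`. -/
lemma integral_min_mul_divergence_le (hφ : ∀ x, φ x = 0 → x = 0) (hη : IsTestField φ η)
    {f : EuclideanSpace ℝ (Fin n) → ℝ} (hf : ContDiff ℝ 1 f) (hfc : HasCompactSupport f) (k : ℝ) :
    ∫ x, min (f x) k * divergence η x ≤ ∫ x in {x | f x < k}, dualNorm φ (fderiv ℝ f x) := by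
  obtain ⟨C, hC⟩ := ContDiff.lipschitzWith_of_hasCompactSupport hfc hf (by norm_num)
  have hm : MeasurableSet {x | f x < k} := measurableSet_lt hf.continuous.measurable
    measurable_const
  rw [integral_mul_divergence (hC.min_const k) hη.1 hη.2.1, ← integral_neg,
    ← integral_indicator hm]
  by_cases hi : Integrable fun x => -(fderiv ℝ (fun x => min (f x) k) x (η x))
  · refine integral_mono hi ((integrable_dualNorm_fderiv hφ hf hfc).indicator hm) fun x => ?_
    dsimp only
    by_cases hx : f x < k
    · have : (fun x => min (f x) k) =ᶠ[𝓝 x] f := by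
        filter_upwards [hf.continuous.continuousAt.eventually_lt_const hx] with y hy
        exact min_eq_left hy.le
      rw [Set.indicator_of_mem (by exact hx), this.fderiv_eq]
      exact neg_fderiv_le_dualNorm hφ hη f x
    · -- At the height `k` the truncation is maximal, so its derivative vanishes (or is junk, zero).
      have : IsLocalMax (fun x => min (f x) k) x := .of_forall fun y => by
        simp only [min_eq_right (not_lt.1 hx)]
        exact min_le_right _ _
      rw [Set.indicator_of_notMem (by exact hx), this.fderiv_eq_zero]
      simp
  · rw [integral_undef hi]
    exact integral_nonneg fun x => Set.indicator_nonneg (fun x _ => dualNorm_nonneg hφ _) x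

/-- A bound on the variation of a `C¹` function is a bound on the integral of the dual norm of its
derivative: a smooth field that nearly realizes the dual norm at every point is patched together
from constant ones by a partition of unity, which the convexity of `φ` allows. -/
lemma integral_dualNorm_le (hφ : ∀ x, φ x = 0 → x = 0)
    {f : EuclideanSpace ℝ (Fin n) → ℝ} (hf : ContDiff ℝ 1 f) (hfc : HasCompactSupport f) {V : ℝ}
    (hV : ∀ η, IsTestField φ η → ∫ x, f x * divergence η x ≤ V) :
    ∫ x, dualNorm φ (fderiv ℝ f x) ≤ V := by
  obtain ⟨C, hC⟩ := ContDiff.lipschitzWith_of_hasCompactSupport hfc hf (by norm_num)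
  have hK : IsCompact (tsupport f) := hfc
  have hKt : volume (tsupport f) ≠ ∞ := hK.measure_lt_top.ne
  have key : ∀ δ > 0, ∫ x, dualNorm φ (fderiv ℝ f x) ≤ V + δ * volume.real (tsupport f) := by
    intro δ hδ
    obtain ⟨g, hg⟩ := exists_contMDiffMap_forall_mem_convex_of_local_const
      (modelWithCornersSelf ℝ (EuclideanSpace ℝ (Fin n))) (n := 1)
      (t := fun x => {y | φ y ≤ 1 ∧ dualNorm φ (fderiv ℝ f x) - δ ≤ fderiv ℝ f x y})
      (fun x => by
        have h1 : Convex ℝ (φ.closedBall 0 1) := φ.convex_closedBall 0 1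
        have h2 : Convex ℝ {y | dualNorm φ (fderiv ℝ f x) - δ ≤ fderiv ℝ f x y} :=
          convex_halfSpace_ge (fderiv ℝ f x).isBoundedLinearMap.toIsLinearMap _
        intro y hy z hz s t hs ht hst
        refine ⟨?_, h2 hy.2 hz.2 hs ht hst⟩
        have := h1 (x := y) (by simpa [Seminorm.mem_closedBall_zero] using hy.1) (y := z)
          (by simpa [Seminorm.mem_closedBall_zero] using hz.1) hs ht hst
        rwa [Seminorm.mem_closedBall_zero] at this)
      (fun x => by
        obtain ⟨y, hy, he⟩ := exists_eq_dualNorm hφ (fderiv ℝ f x)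
        refine ⟨y, ?_⟩
        have hc : Continuous fun z => fderiv ℝ f z y - dualNorm φ (fderiv ℝ f z) :=
          ((hf.continuous_fderiv (by norm_num)).clm_apply continuous_const).sub
            (continuous_dualNorm_fderiv hφ hf)
        have := hc.continuousAt (x := x) |>.eventually_const_lt (u := -δ) (by simp [he, hδ])
        filter_upwards [this] with z hz
        exact ⟨hy, by linarith⟩)
    obtain ⟨R, hR, hsub⟩ := hK.isBounded.subset_closedBall_lt 0 0
    let b : ContDiffBump (0 : EuclideanSpace ℝ (Fin n)) := ⟨R, R + 1, hR, by linarith⟩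
    have hη : IsTestField φ fun x => -(b x • g x) := by
      refine ⟨(b.contDiff.smul g.contMDiff.contDiff).neg, ?_, fun x => ?_⟩
      · exact b.hasCompactSupport.mono fun x hx h0 => hx (by simp [h0])
      · rw [map_neg_eq_map, map_smul_eq_mul, Real.norm_of_nonneg b.nonneg]
        exact mul_le_one₀ b.le_one (apply_nonneg _ _) (hg x).1
    have h1 := hV _ hη
    rw [integral_mul_divergence hC hη.1 hη.2.1, ← integral_neg] at h1
    simp only [map_neg, neg_neg] at h1
    have hm : MeasurableSet (tsupport f) := (isClosed_tsupport f).measurableSet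
    have hi : Integrable fun x => fderiv ℝ f x (b x • g x) :=
      ((hf.continuous_fderiv (by norm_num)).clm_apply
        (b.continuous.smul g.contMDiff.continuous)).integrable_of_hasCompactSupport
        ((hfc.fderiv (𝕜 := ℝ)).mono' fun x hx => subset_closure fun h0 => hx (by simp [h0]))
    have hind : Integrable ((tsupport f).indicator fun _ => δ) :=
      (integrable_indicator_iff hm).2 (integrableOn_const hKt)
    calc ∫ x, dualNorm φ (fderiv ℝ f x)
        ≤ ∫ x, (fderiv ℝ f x (b x • g x) + (tsupport f).indicator (fun _ => δ) x) := by
          refine integral_mono (integrable_dualNorm_fderiv hφ hf hfc) (hi.add hind) fun x => ?_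
          dsimp only
          by_cases hx : x ∈ tsupport f
          · rw [Set.indicator_of_mem hx, b.one_of_mem_closedBall (hsub hx), one_smul]
            linarith [(hg x).2]
          · rw [Set.indicator_of_notMem hx, fderiv_of_notMem_tsupport _ hx, dualNorm_zero]
            simp
      _ = (∫ x, fderiv ℝ f x (b x • g x)) + δ * volume.real (tsupport f) := by
          rw [integral_add hi hind, integral_indicator hm, setIntegral_const, smul_eq_mul, mul_comm]
      _ ≤ _ := by gcongr
  -- The volume of the support may vanish, hence the `+ 1` in the choice of `δ`.
  refine le_of_forall_pos_le_add fun ε hε => ?_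
  refine (key (ε / (volume.real (tsupport f) + 1)) (by positivity)).trans ?_
  gcongr
  rw [div_mul_eq_mul_div, div_le_iff₀ (by positivity)]
  gcongr
  linarith

/-! ### The isoperimetric inequality above a level of a smooth function -/

/-- A `C¹` function of compact support grows at most at the rate `dualNorm φ (fderiv ℝ f x)` in
directions of the unit ball, uniformly in the base point `x`. -/
lemma eventually_forall_le_add_mul_dualNorm (hφ : ∀ x, φ x = 0 → x = 0)
    {f : EuclideanSpace ℝ (Fin n) → ℝ} (hf : ContDiff ℝ 1 f) (hfc : HasCompactSupport f)
    {ε : ℝ} (hε : 0 < ε) :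
    ∀ᶠ t in 𝓝[>] (0 : ℝ), ∀ x y, φ y ≤ 1 →
      f (x + t • y) ≤ f x + t * (dualNorm φ (fderiv ℝ f x) + ε) := by
  obtain ⟨c, hc, hcφ⟩ := exists_norm_le_mul_seminorm hφ
  have hu : UniformContinuous (fderiv ℝ f) :=
    (hf.continuous_fderiv (by norm_num)).uniformContinuous_of_tendsto_cocompact
      (hfc.fderiv (𝕜 := ℝ)).is_zero_at_infty
  obtain ⟨δ, hδ, hδf⟩ := Metric.uniformContinuous_iff.1 hu (ε / c) (by positivity)
  filter_upwards [Ioo_mem_nhdsGT (show 0 < δ / c by positivity)] with t ht x y hy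
  have hyc : ‖y‖ ≤ c := (hcφ y).trans (by nlinarith)
  have hty : ‖t • y‖ < δ := by
    rw [norm_smul, Real.norm_of_nonneg ht.1.le]
    calc t * ‖y‖ ≤ t * c := by gcongr; exact ht.1.le
      _ < δ / c * c := by gcongr; exact ht.2
      _ = δ := by field_simp
  have hmv := (convex_ball x δ).norm_image_sub_le_of_norm_fderiv_le' (𝕜 := ℝ) (f := f)
    (φ := fderiv ℝ f x) (C := ε / c) (x := x) (y := x + t • y)
    (fun z _ => hf.differentiable (by norm_num) z)
    (fun z hz => by
      rw [← dist_eq_norm]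
      exact (hδf (Metric.mem_ball.1 hz)).le)
    (Metric.mem_ball_self hδ) (by simpa [mem_ball_iff_norm] using hty)
  rw [add_sub_cancel_left, map_smul, smul_eq_mul, norm_smul, Real.norm_of_nonneg ht.1.le] at hmv
  have h1 := (abs_le.1 hmv).2
  have h2 : ε / c * (t * ‖y‖) ≤ t * ε := by
    calc ε / c * (t * ‖y‖) ≤ ε / c * (t * c) := by gcongr; exact ht.1.le
      _ = t * ε := by field_simp
  have h3 := mul_le_mul_of_nonneg_left (le_dualNorm hφ (fderiv ℝ f x) hy) ht.1.le
  linarith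

lemma exists_volume_lt_level_le {f : EuclideanSpace ℝ (Fin n) → ℝ} (hf : Continuous f)
    (hfc : HasCompactSupport f) {k : ℝ} (hk : 0 < k) {ε : ℝ≥0∞} (hε : ε ≠ 0) :
    ∃ θ > 0, volume {x | k - θ < f x ∧ f x < k} ≤ ε := by
  have hanti : Antitone fun j : ℕ => {x | k - k / (j + 1) < f x ∧ f x < k} := by
    intro i j hij x hx
    refine ⟨lt_of_le_of_lt ?_ hx.1, hx.2⟩
    gcongr
  have hm : ∀ j : ℕ, MeasurableSet {x | k - k / (j + 1) < f x ∧ f x < k} := fun j =>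
    ((isOpen_lt continuous_const hf).inter (isOpen_lt hf continuous_const)).measurableSet
  have hsub : {x | k - k / ((0 : ℕ) + 1) < f x ∧ f x < k} ⊆ tsupport f := fun x hx =>
    subset_tsupport f (by
      have : 0 < f x := by simpa using hx.1
      exact this.ne')
  have ht := tendsto_measure_iInter_atTop (μ := volume) (fun j => (hm j).nullMeasurableSet) hanti
    ⟨0, ((measure_mono hsub).trans_lt hfc.isCompact.measure_lt_top).ne⟩
  have he : ⋂ j : ℕ, {x | k - k / (j + 1) < f x ∧ f x < k} = ∅ := by
    ext x
    simp only [Set.mem_iInter, Set.mem_ofPred_eq, Set.mem_empty_iff_false, iff_false, not_forall]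
    by_contra! hx
    have hlim : Tendsto (fun j : ℕ => k - k / ((j : ℝ) + 1)) atTop (𝓝 (k - 0)) :=
      tendsto_const_nhds.sub (by
        simpa [div_eq_mul_inv] using (tendsto_one_div_add_atTop_nhds_zero_nat (𝕜 := ℝ)).const_mul k)
    have := le_of_tendsto' hlim fun j => (hx j).1.le
    linarith [(hx 0).2]
  rw [he, measure_empty] at ht
  obtain ⟨j, hj⟩ := (ht.eventually (Iic_mem_nhds (pos_iff_ne_zero.2 hε))).exists
  exact ⟨k / (j + 1), by positivity, hj⟩

/-- The Brunn–Minkowski inequality for the superlevel sets of `f` above the level `k`, integrated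
over the levels. It compares the enlargements of these sets by `tW`, with `W` the unit ball of `φ`,
with the superlevel sets of an explicit majorant of the supremum of `f` over `x + tW`. -/
lemma exists_mul_lintegral_min_le_add (hn : n ≠ 0) (hφ : ∀ x, φ x = 0 → x = 0)
    {f : EuclideanSpace ℝ (Fin n) → ℝ} (hf : ContDiff ℝ 1 f) (hfc : HasCompactSupport f)
    {k ρ : ℝ} (hk : 0 < k) (hρ : 0 < ρ) :
    ∃ M : ℝ≥0∞, M ≠ ∞ ∧ ∀ ε ∈ Set.Ioo (0 : ℝ) 1,
    ENNReal.ofReal (n / ρ) * ∫⁻ s in Set.Ioi 0,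
      min (volume {x | k + s < f x}) (ENNReal.ofReal (ρ ^ n) * volume (φ.closedBall 0 1))
      ≤ (∫⁻ x in {x | k ≤ f x}, ENNReal.ofReal (dualNorm φ (fderiv ℝ f x)))
        + ENNReal.ofReal ε * M := by
  have hfcont := hf.continuous
  obtain ⟨c, hc, hcφ⟩ := exists_norm_le_mul_seminorm hφ
  obtain ⟨R, hR⟩ := hfc.isCompact.isBounded.subset_closedBall (0 : EuclideanSpace ℝ (Fin n))
  obtain ⟨L, hL⟩ : ∃ L, ∀ x, dualNorm φ (fderiv ℝ f x) ≤ L := by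
    obtain ⟨L, hL⟩ := ((hfc.fderiv (𝕜 := ℝ)).comp_left
      (g := dualNorm φ) dualNorm_zero).exists_bound_of_continuous
      (continuous_dualNorm_fderiv hφ hf)
    exact ⟨L, fun x => (le_abs_self _).trans (hL x)⟩
  have hL0 : 0 ≤ L := (dualNorm_nonneg hφ _).trans (hL 0)
  set K' := Metric.closedBall (0 : EuclideanSpace ℝ (Fin n)) (R + c) with hK'
  have hK't : volume K' ≠ ∞ := measure_closedBall_lt_top.ne
  refine ⟨volume K' + ENNReal.ofReal (L + 1), by simp [hK't], fun ε hε => ?_⟩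
  obtain ⟨θ, hθ, hθv⟩ := exists_volume_lt_level_le hfcont hfc hk (ε := ENNReal.ofReal ε)
    (by simpa using hε.1)
  obtain ⟨t, hgrow, ht0, htm⟩ := ((eventually_forall_le_add_mul_dualNorm hφ hf hfc hε.1).and
    (Ioo_mem_nhdsGT (show 0 < min 1 (θ / (L + 1)) by positivity))).exists
  have ht1 : t ≤ 1 := htm.le.trans (min_le_left _ _)
  have htθ : t * (L + 1) ≤ θ := by
    rw [← le_div_iff₀ (by positivity)]
    exact htm.le.trans (min_le_right _ _)
  set S₁ := {x | k ≤ f x} with hS₁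
  set S₂ := {x | k - t * (L + 1) < f x ∧ f x < k} with hS₂
  have hS₁m : MeasurableSet S₁ := (isClosed_le continuous_const hfcont).measurableSet
  have hS₂m : MeasurableSet S₂ :=
    ((isOpen_lt continuous_const hfcont).inter (isOpen_lt hfcont continuous_const)).measurableSet
  have hK'm : MeasurableSet K' := Metric.isClosed_closedBall.measurableSet
  set Φ : EuclideanSpace ℝ (Fin n) → ℝ := fun x => dualNorm φ (fderiv ℝ f x) with hΦ
  have hΦ0 : ∀ x, 0 ≤ Φ x := fun x => dualNorm_nonneg hφ _
  have hΦc : Continuous Φ := continuous_dualNorm_fderiv hφ hf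
  -- The majorant has slope `Φ + ε` in `t` on `{f ≥ k}`. On `{f < k}` the enlargement can exceed the
  -- level `k` only in the thin layer `S₂`, by at most `t * (L + 1)`.
  set G : EuclideanSpace ℝ (Fin n) → ℝ := fun x => max (f x - k) 0 + S₁.indicator (fun x => t * Φ x) x
    + K'.indicator (fun _ => t * ε) x + S₂.indicator (fun _ => t * (L + 1)) x with hG
  have i1 : ∀ x, 0 ≤ max (f x - k) 0 := fun x => le_max_right _ _
  have i2 : ∀ x, 0 ≤ S₁.indicator (fun x => t * Φ x) x := fun x =>
    Set.indicator_nonneg (fun x _ => mul_nonneg ht0.le (hΦ0 x)) x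
  have i3 : ∀ x, 0 ≤ K'.indicator (fun _ => t * ε) x := fun x =>
    Set.indicator_nonneg (fun x _ => mul_nonneg ht0.le hε.1.le) x
  have i4 : ∀ x, 0 ≤ S₂.indicator (fun _ => t * (L + 1)) x := fun x =>
    Set.indicator_nonneg (fun x _ => mul_nonneg ht0.le (by linarith)) x
  have m1 : Measurable fun x => max (f x - k) 0 :=
    ((hfcont.sub continuous_const).max continuous_const).measurable
  have m2 : Measurable (S₁.indicator fun x => t * Φ x) :=
    (hΦc.measurable.const_mul t).indicator hS₁m
  have m3 : Measurable (K'.indicator fun _ => t * ε) := measurable_const.indicator hK'm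
  have m4 : Measurable (S₂.indicator fun _ => t * (L + 1)) := measurable_const.indicator hS₂m
  have hGm : Measurable G := ((m1.add m2).add m3).add m4
  have hincl : ∀ s, 0 < s → ∀ z ∈ {x | k + s < f x}, ∀ w ∈ φ.closedBall 0 1,
      z + t • w ∈ {x | s < G x} := by
    intro s hs z hz w hw
    rw [Seminorm.mem_closedBall_zero] at hw
    have hz : k + s < f z := hz
    set x := z + t • w with hx
    have hzx : f z ≤ f x + t * (Φ x + ε) := by
      have := hgrow x (-w) (by simpa using hw)
      rwa [show x + t • -w = z by simp [hx]] at this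
    have hxK : x ∈ K' := by
      have h1 : ‖z‖ ≤ R := by
        simpa using hR (subset_tsupport f (show f z ≠ 0 by linarith))
      have h2 : ‖t • w‖ ≤ c := by
        rw [norm_smul, Real.norm_of_nonneg ht0.le]
        have := hcφ w
        have h3 : ‖w‖ ≤ c := this.trans (by nlinarith)
        calc t * ‖w‖ ≤ 1 * c := by gcongr
          _ = c := one_mul c
      rw [hK', mem_closedBall_zero_iff]
      exact (norm_add_le _ _).trans (add_le_add h1 h2)
    show s < G x
    by_cases hxk : k ≤ f x
    · have e2 : S₁.indicator (fun x => t * Φ x) x = t * Φ x := 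
        Set.indicator_of_mem (show x ∈ S₁ from hxk) _
      have e3 : K'.indicator (fun _ => t * ε) x = t * ε := Set.indicator_of_mem hxK _
      have := i4 x
      have := le_max_left (f x - k) 0
      simp only [hG, e2, e3]
      linarith
    · have hLx : t * (Φ x + ε) ≤ t * (L + 1) := by
        have := hL x
        have := hε.2
        gcongr
      have hx2 : x ∈ S₂ := ⟨by linarith, not_le.1 hxk⟩
      have e4 : S₂.indicator (fun _ => t * (L + 1)) x = t * (L + 1) := Set.indicator_of_mem hx2 _
      have := i1 x
      have := i2 x
      have := i3 x
      simp only [hG, e4]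
      linarith [not_le.1 hxk]
  set B := ENNReal.ofReal (ρ ^ n) * volume (φ.closedBall 0 1) with hB
  have hWm : MeasurableSet (φ.closedBall 0 1) :=
    (isCompact_closedBall_seminorm hφ 0 1).isClosed.measurableSet
  have hmeas : Measurable fun s : ℝ => volume {x | k + s < f x} := by
    have : Antitone fun s : ℝ => volume {x | k + s < f x} := fun s s' hss =>
      measure_mono fun x (hx : k + s' < f x) => show k + s < f x by linarith
    exact this.measurable
  have hlevel : ∀ s ∈ Set.Ioi (0 : ℝ), volume {x | k + s < f x}
      + ENNReal.ofReal (n * t / ρ) * min (volume {x | k + s < f x}) B ≤ volume {x | s < G x} := by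
    intro s hs
    refine add_mul_min_le_volume_of_add_smul_mem hn
      (isOpen_lt continuous_const hfcont).measurableSet hWm (measurableSet_lt measurable_const hGm)
      ht0 hρ (hincl s hs) ?_ (volume_closedBall_seminorm_pos φ).ne'
      (isCompact_closedBall_seminorm hφ 0 1).measure_lt_top.ne
    refine ((measure_mono fun x hx => subset_tsupport f ?_).trans_lt hfc.isCompact.measure_lt_top).ne
    have hx : k + s < f x := hx
    have hs : 0 < s := hs
    exact (show f x ≠ 0 by linarith)
  have hJ : ∫⁻ s in Set.Ioi (0 : ℝ), volume {x | k + s < f x}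
      = ∫⁻ x, ENNReal.ofReal (max (f x - k) 0) := by
    rw [lintegral_eq_lintegral_meas_lt volume (.of_forall i1) m1.aemeasurable]
    refine setLIntegral_congr_fun measurableSet_Ioi fun s hs => ?_
    have hs : 0 < s := hs
    congr 1
    ext x
    simp only [Set.mem_ofPred_eq, lt_max_iff, hs.not_gt, or_false, lt_sub_iff_add_lt']
  have hJt : ∫⁻ x, ENNReal.ofReal (max (f x - k) 0) ≠ ∞ := by
    have hcs : HasCompactSupport fun x => max (f x - k) 0 :=
      hfc.comp_left (g := fun y => max (y - k) 0) (by simp [hk.le])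
    exact (((hfcont.sub continuous_const).max continuous_const).integrable_of_hasCompactSupport
      hcs).lintegral_lt_top.ne
  have hmain : (∫⁻ x, ENNReal.ofReal (max (f x - k) 0))
      + ENNReal.ofReal (n * t / ρ) * (∫⁻ s in Set.Ioi 0, min (volume {x | k + s < f x}) B)
      ≤ (∫⁻ x, ENNReal.ofReal (max (f x - k) 0)) + ENNReal.ofReal t *
        ((∫⁻ x in S₁, ENNReal.ofReal (Φ x)) + ENNReal.ofReal ε * volume K'
          + ENNReal.ofReal (L + 1) * volume S₂) := by
    calc _ = ∫⁻ s in Set.Ioi 0, (volume {x | k + s < f x}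
            + ENNReal.ofReal (n * t / ρ) * min (volume {x | k + s < f x}) B) := by
          rw [lintegral_add_left hmeas, hJ, lintegral_const_mul' _ _ (by simp)]
      _ ≤ ∫⁻ s in Set.Ioi 0, volume {x | s < G x} := setLIntegral_mono' measurableSet_Ioi hlevel
      _ = ∫⁻ x, ENNReal.ofReal (G x) :=
          (lintegral_eq_lintegral_meas_lt volume (.of_forall fun x => by
            have := i1 x
            have := i2 x
            have := i3 x
            have := i4 x
            simp only [hG, Pi.zero_apply]
            positivity) hGm.aemeasurable).symm
      _ = _ := by
          have hind : ∀ {S : Set (EuclideanSpace ℝ (Fin n))} {F : EuclideanSpace ℝ (Fin n) → ℝ} x,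
              ENNReal.ofReal (S.indicator F x) = S.indicator (fun x => ENNReal.ofReal (F x)) x := by
            intro S F x
            by_cases hx : x ∈ S <;> simp [hx]
          have e : ∀ x, ENNReal.ofReal (G x) = ENNReal.ofReal (max (f x - k) 0)
              + S₁.indicator (fun x => ENNReal.ofReal t * ENNReal.ofReal (Φ x)) x
              + K'.indicator (fun _ => ENNReal.ofReal t * ENNReal.ofReal ε) x
              + S₂.indicator (fun _ => ENNReal.ofReal t * ENNReal.ofReal (L + 1)) x := by
            intro x
            simp only [hG]
            rw [ENNReal.ofReal_add (add_nonneg (add_nonneg (i1 x) (i2 x)) (i3 x)) (i4 x),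
              ENNReal.ofReal_add (add_nonneg (i1 x) (i2 x)) (i3 x),
              ENNReal.ofReal_add (i1 x) (i2 x), hind, hind, hind]
            simp only [ENNReal.ofReal_mul ht0.le]
          have mΦ : Measurable fun x => ENNReal.ofReal (Φ x) := hΦc.measurable.ennreal_ofReal
          simp only [e]
          rw [lintegral_add_right _ (measurable_const.indicator hS₂m),
            lintegral_add_right _ (measurable_const.indicator hK'm),
            lintegral_add_right _ ((mΦ.const_mul _).indicator hS₁m),
            lintegral_indicator hS₁m, lintegral_indicator hK'm, lintegral_indicator hS₂m,
            lintegral_const_mul _ mΦ, setLIntegral_const, setLIntegral_const]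
          ring
  rw [ENNReal.add_le_add_iff_left hJt, show (n : ℝ) * t / ρ = t * (n / ρ) by ring,
    ENNReal.ofReal_mul ht0.le, mul_assoc,
    ENNReal.mul_le_mul_iff_right (by simpa using ht0) ENNReal.ofReal_ne_top] at hmain
  refine hmain.trans ?_
  have hS₂v : volume S₂ ≤ ENNReal.ofReal ε :=
    
    (measure_mono (show S₂ ⊆ {x | k - θ < f x ∧ f x < k} from fun x hx =>
      ⟨by linarith [hx.1], hx.2⟩)).trans hθv
  rw [mul_add, add_assoc, mul_comm (ENNReal.ofReal (L + 1))]
  gcongr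

/-- The isoperimetric inequality for the superlevel sets of `f` above the level `k`, integrated over
the levels. A superlevel set no larger than the ball `ρW`, with `W` the unit ball of `φ`, contributes
at least `n / ρ` times its volume, because `n / ρ` is the ratio of perimeter to volume of `ρW`. -/
lemma mul_lintegral_min_le (hn : n ≠ 0) (hφ : ∀ x, φ x = 0 → x = 0)
    {f : EuclideanSpace ℝ (Fin n) → ℝ} (hf : ContDiff ℝ 1 f) (hfc : HasCompactSupport f)
    {k ρ : ℝ} (hk : 0 < k) (hρ : 0 < ρ) :
    ENNReal.ofReal (n / ρ) * ∫⁻ s in Set.Ioi 0,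
      min (volume {x | k + s < f x}) (ENNReal.ofReal (ρ ^ n) * volume (φ.closedBall 0 1))
      ≤ ∫⁻ x in {x | k ≤ f x}, ENNReal.ofReal (dualNorm φ (fderiv ℝ f x)) := by
  -- The limit `ε → 0`.
  obtain ⟨M, hM, h⟩ := exists_mul_lintegral_min_le_add hn hφ hf hfc hk hρ
  have ht : Tendsto (fun ε : ℝ => (∫⁻ x in {x | k ≤ f x},
      ENNReal.ofReal (dualNorm φ (fderiv ℝ f x))) + ENNReal.ofReal ε * M) (𝓝[>] 0)
      (𝓝 ((∫⁻ x in {x | k ≤ f x}, ENNReal.ofReal (dualNorm φ (fderiv ℝ f x)))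
        + ENNReal.ofReal 0 * M)) := by
    refine tendsto_const_nhds.add (ENNReal.Tendsto.mul_const ?_ (.inr hM))
    exact (ENNReal.continuous_ofReal.tendsto 0).mono_left nhdsWithin_le_nhds
  rw [ENNReal.ofReal_zero, zero_mul, add_zero] at ht
  exact ge_of_tendsto ht (by
    filter_upwards [Ioo_mem_nhdsGT (zero_lt_one' ℝ)] with ε hε using h ε hε)

/-! ### Smooth approximation -/

lemma integrable_divergence (hη : IsTestField φ η) : Integrable (divergence η) :=
  (continuous_divergence hη.1).integrable_of_hasCompactSupport (hasCompactSupport_divergence hη.2.1)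

lemma exists_bound_divergence (hη : IsTestField φ η) : ∃ C, ∀ x, ‖divergence η x‖ ≤ C :=
  (hasCompactSupport_divergence hη.2.1).exists_bound_of_continuous (continuous_divergence hη.1)

lemma integrable_mul_divergence (hη : IsTestField φ η) {u : EuclideanSpace ℝ (Fin n) → ℝ}
    (hu : Integrable u) : Integrable fun x => u x * divergence η x := by
  obtain ⟨C, hC⟩ := exists_bound_divergence hη
  exact hu.mul_bdd (continuous_divergence hη.1).aestronglyMeasurable (.of_forall hC)

lemma divergence_comp_add_right (η : EuclideanSpace ℝ (Fin n) → EuclideanSpace ℝ (Fin n))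
    (t x : EuclideanSpace ℝ (Fin n)) :
    divergence (fun y => η (y + t)) x = divergence η (x + t) := by
  simp only [divergence, fderiv_comp_add_right]

lemma IsTestField.comp_add_right (hη : IsTestField φ η) (t : EuclideanSpace ℝ (Fin n)) :
    IsTestField φ fun y => η (y + t) :=
  ⟨hη.1.comp (contDiff_id.add contDiff_const),
    hη.2.1.comp_homeomorph (Homeomorph.addRight t), fun _ => hη.2.2 _⟩

open scoped Convolution in
/-- Averaging translates does not increase the variation, as translates of test fields are test
fields. -/
lemma integral_convolution_mul_divergence_le {u ψ : EuclideanSpace ℝ (Fin n) → ℝ}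
    (hu : Integrable u) (hψ : Integrable ψ) (hψ0 : ∀ x, 0 ≤ ψ x) (hψ1 : ∫ x, ψ x = 1) {V : ℝ}
    (hV : ∀ η, IsTestField φ η → ∫ x, u x * divergence η x ≤ V) (hη : IsTestField φ η) :
    ∫ x, (ψ ⋆[ContinuousLinearMap.lsmul ℝ ℝ, volume] u) x * divergence η x ≤ V := by
  obtain ⟨C, hC⟩ := exists_bound_divergence hη
  have hi : Integrable (fun p : EuclideanSpace ℝ (Fin n) × EuclideanSpace ℝ (Fin n) =>
      (ψ p.2 * u (p.1 - p.2)) * divergence η p.1) (volume.prod volume) :=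
    (hψ.convolution_integrand (ContinuousLinearMap.lsmul ℝ ℝ) hu).mul_bdd
      ((continuous_divergence hη.1).comp continuous_fst).aestronglyMeasurable
      (.of_forall fun p => hC p.1)
  have hinner : ∀ t, ∫ x, ψ t * u (x - t) * divergence η x
      = ψ t * ∫ x, u x * divergence (fun y => η (y + t)) x := by
    intro t
    rw [← integral_add_right_eq_self _ t]
    simp only [add_sub_cancel_right, mul_assoc, integral_const_mul, divergence_comp_add_right]
  calc ∫ x, (ψ ⋆[ContinuousLinearMap.lsmul ℝ ℝ, volume] u) x * divergence η x
      = ∫ x, ∫ t, ψ t * u (x - t) * divergence η x := by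
        congr 1
        ext x
        rw [convolution_def, ← integral_mul_const]
        rfl
    _ = ∫ t, ∫ x, ψ t * u (x - t) * divergence η x := integral_integral_swap hi
    _ ≤ ∫ t, ψ t * V := by
        refine integral_mono ?_ (hψ.mul_const V) fun t => ?_
        · exact hi.integral_prod_right
        · dsimp only
          rw [hinner]
          exact mul_le_mul_of_nonneg_left (hV _ (hη.comp_add_right t)) (hψ0 t)
    _ = V := by rw [integral_mul_const, hψ1, one_mul]

lemma divergence_smul {χ : EuclideanSpace ℝ (Fin n) → ℝ} (hχ : ContDiff ℝ 1 χ)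
    (hη : ContDiff ℝ 1 η) (x : EuclideanSpace ℝ (Fin n)) :
    divergence (fun y => χ y • η y) x = χ x * divergence η x + fderiv ℝ χ x (η x) := by
  have h : ∀ v, fderiv ℝ (fun y => χ y • η y) x v = χ x • fderiv ℝ η x v + fderiv ℝ χ x v • η x := by
    intro v
    rw [fderiv_fun_smul (hχ.differentiable (by norm_num) x) (hη.differentiable (by norm_num) x)]
    rfl
  have hx' : η x = ∑ i, η x i • EuclideanSpace.single i (1 : ℝ) := by
    simpa using ((EuclideanSpace.basisFun (Fin n) ℝ).sum_repr (η x)).symm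
  conv_rhs => rw [hx', map_sum]
  simp only [divergence, h, PiLp.add_apply, PiLp.smul_apply, smul_eq_mul, Finset.sum_add_distrib,
    Finset.mul_sum, map_smul]
  congr 1
  exact Finset.sum_congr rfl fun i _ => mul_comm _ _

/-- A smooth cutoff with derivative bounded by `C` increases the variation of an integrable function
by at most a multiple of `C`. -/
lemma integral_cutoff_mul_divergence_le {w χ : EuclideanSpace ℝ (Fin n) → ℝ} (hw : Integrable w)
    (hχ : ContDiff ℝ 1 χ) (hχ0 : ∀ x, 0 ≤ χ x) (hχ1 : ∀ x, χ x ≤ 1) {c C : ℝ} (hc : 0 ≤ c)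
    (hcφ : ∀ x, ‖x‖ ≤ c * φ x) (hC : ∀ x, ‖fderiv ℝ χ x‖ ≤ C) {V : ℝ}
    (hV : ∀ η, IsTestField φ η → ∫ x, w x * divergence η x ≤ V) (hη : IsTestField φ η) :
    ∫ x, (χ x * w x) * divergence η x ≤ V + C * c * ∫ x, ‖w x‖ := by
  have hC0 : 0 ≤ C := (norm_nonneg _).trans (hC 0)
  have hη' : IsTestField φ fun y => χ y • η y := by
    refine ⟨hχ.smul hη.1, ?_, fun x => ?_⟩
    · exact hη.2.1.mono fun x hx h0 => hx (by simp [h0])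
    · rw [map_smul_eq_mul, Real.norm_of_nonneg (hχ0 x)]
      exact mul_le_one₀ (hχ1 x) (apply_nonneg _ _) (hη.2.2 x)
  have hb : ∀ x, ‖fderiv ℝ χ x (η x)‖ ≤ C * c := fun x => by
    refine ((fderiv ℝ χ x).le_opNorm _).trans ?_
    have h1 : ‖η x‖ ≤ c := (hcφ _).trans (by nlinarith [hη.2.2 x])
    have := hC x
    gcongr
  have hcont : Continuous fun x => fderiv ℝ χ x (η x) :=
    (hχ.continuous_fderiv (by norm_num)).clm_apply hη.1.continuous
  have hi2 : Integrable fun x => w x * fderiv ℝ χ x (η x) :=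
    hw.mul_bdd hcont.aestronglyMeasurable (.of_forall hb)
  calc ∫ x, (χ x * w x) * divergence η x
      = ∫ x, (w x * divergence (fun y => χ y • η y) x - w x * fderiv ℝ χ x (η x)) := by
        congr 1
        ext x
        rw [divergence_smul hχ hη.1]
        ring
    _ = (∫ x, w x * divergence (fun y => χ y • η y) x) - ∫ x, w x * fderiv ℝ χ x (η x) :=
        integral_sub (integrable_mul_divergence hη' hw) hi2
    _ ≤ V + ∫ x, C * c * ‖w x‖ := by
        rw [sub_eq_add_neg, ← integral_neg]
        have hle : ∀ x, -(w x * fderiv ℝ χ x (η x)) ≤ C * c * ‖w x‖ := fun x => by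
          refine (neg_le_abs _).trans ?_
          rw [abs_mul, mul_comm]
          exact mul_le_mul_of_nonneg_right (hb x) (abs_nonneg _)
        exact add_le_add (hV _ hη') (integral_mono hi2.neg (hw.norm.const_mul _) hle)
    _ = _ := by rw [integral_const_mul]

open scoped Convolution in
/-- Mollifications of `u`, cut off at ever larger radii, have asymptotically no more variation than
`u`. Convergence almost everywhere is all that the passage to the limit needs, since the functions
are truncated there. -/
lemma exists_smooth_approximation (hφ : ∀ x, φ x = 0 → x = 0) {u : EuclideanSpace ℝ (Fin n) → ℝ}
    (hu : Integrable u) (hu0 : ∀ x, 0 ≤ u x) {V : ℝ}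
    (hV : ∀ η, IsTestField φ η → ∫ x, u x * divergence η x ≤ V) :
    ∃ (f : ℕ → EuclideanSpace ℝ (Fin n) → ℝ) (v : ℕ → ℝ), (∀ j, ContDiff ℝ 1 (f j)) ∧
      (∀ j, HasCompactSupport (f j)) ∧ (∀ j x, 0 ≤ f j x) ∧
      (∀ j η, IsTestField φ η → ∫ x, f j x * divergence η x ≤ v j) ∧ Tendsto v atTop (𝓝 V) ∧
      ∀ᵐ x, Tendsto (fun j => f j x) atTop (𝓝 (u x)) := by
  obtain ⟨c, hc, hcφ⟩ := exists_norm_le_mul_seminorm hφ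
  let b : ContDiffBump (0 : EuclideanSpace ℝ (Fin n)) := ⟨1, 2, one_pos, one_lt_two⟩
  obtain ⟨B, hB⟩ := (b.hasCompactSupport.fderiv (𝕜 := ℝ)).exists_bound_of_continuous
    (b.contDiff.continuous_fderiv (n := 1) (by norm_num))
  let ψ : ℕ → ContDiffBump (0 : EuclideanSpace ℝ (Fin n)) := fun j =>
    ⟨1 / ((j : ℝ) + 1), 2 / ((j : ℝ) + 1), by positivity, by gcongr; norm_num⟩
  let w : ℕ → EuclideanSpace ℝ (Fin n) → ℝ := fun j =>
    (ψ j).normed volume ⋆[ContinuousLinearMap.lsmul ℝ ℝ, volume] u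
  let χ : ℕ → EuclideanSpace ℝ (Fin n) → ℝ := fun j x => b (((j : ℝ) + 1)⁻¹ • x)
  have hχ : ∀ j, ContDiff ℝ 1 (χ j) := fun j => b.contDiff.comp (contDiff_const_smul _)
  have hχd : ∀ j x, ‖fderiv ℝ (χ j) x‖ ≤ ((j : ℝ) + 1)⁻¹ * B := fun j x => by
    have : fderiv ℝ (χ j) x = ((j : ℝ) + 1)⁻¹ • fderiv ℝ b (((j : ℝ) + 1)⁻¹ • x) :=
      fderiv_comp_smul _
    rw [this, norm_smul, Real.norm_of_nonneg (by positivity)]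
    gcongr
    exact hB _
  have hψi : ∀ j, Integrable ((ψ j).normed volume) := fun j =>
    (ψ j).integrable_normed
  have hwi : ∀ j, Integrable (w j) := fun j => (hψi j).integrable_convolution _ hu
  have hw0 : ∀ j x, 0 ≤ w j x := fun j x =>
    integral_nonneg fun t => mul_nonneg ((ψ j).nonneg_normed t) (hu0 _)
  have hws : ∀ j, ContDiff ℝ 1 (w j) := fun j =>
    (ψ j).hasCompactSupport_normed.contDiff_convolution_left (n := 1) _ (ψ j).contDiff_normed
      hu.locallyIntegrable
  have hw1 : ∀ j, ∫ x, ‖w j x‖ = ∫ x, u x := fun j => by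
    simp only [Real.norm_of_nonneg (hw0 j _)]
    have := integral_convolution (ContinuousLinearMap.lsmul ℝ ℝ) (hψi j) hu
    rw [(ψ j).integral_normed] at this
    simpa using this
  refine ⟨fun j x => χ j x * w j x, fun j => V + ((j : ℝ) + 1)⁻¹ * B * c * ∫ x, u x,
    fun j => (hχ j).mul (hws j), fun j => ?_, fun j x => mul_nonneg b.nonneg (hw0 j x), ?_, ?_, ?_⟩
  · exact (b.hasCompactSupport.comp_smul (c := ((j : ℝ) + 1)⁻¹) (by positivity)).mul_right
  · intro j η hη
    have := integral_cutoff_mul_divergence_le (hwi j) (hχ j) (fun x => b.nonneg)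
      (fun x => b.le_one) hc.le hcφ (hχd j) (fun η hη => integral_convolution_mul_divergence_le hu
        (hψi j) (ψ j).nonneg_normed (ψ j).integral_normed hV hη) hη
    rwa [hw1] at this
  · have h1 : Tendsto (fun j : ℕ => ((j : ℝ) + 1)⁻¹) atTop (𝓝 0) := by
      simpa using tendsto_one_div_add_atTop_nhds_zero_nat (𝕜 := ℝ)
    simpa using tendsto_const_nhds.add (((h1.mul_const B).mul_const c).mul_const (∫ x, u x))
  · have hr : Tendsto (fun j => (ψ j).rOut) atTop (𝓝 0) := by
      have := (tendsto_one_div_add_atTop_nhds_zero_nat (𝕜 := ℝ)).const_mul 2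
      simpa [ψ, div_eq_mul_inv] using this
    have hK : ∀ᶠ j in atTop, (ψ j).rOut ≤ 2 * (ψ j).rIn := .of_forall fun j => by
      simp only [ψ]
      exact le_of_eq (by ring)
    filter_upwards [ContDiffBump.ae_convolution_tendsto_right_of_locallyIntegrable (μ := volume)
      hr hK hu.locallyIntegrable] with x hx
    refine hx.congr' ?_
    filter_upwards [eventually_ge_atTop ⌈‖x‖⌉₊] with j hj
    have hxj : ‖x‖ ≤ (j : ℝ) + 1 := (Nat.ceil_le.1 hj).trans (by linarith)
    have : χ j x = 1 := by
      refine b.one_of_mem_closedBall ?_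
      rw [mem_closedBall_zero_iff, norm_smul, Real.norm_of_nonneg (by positivity)]
      show _ ≤ (1 : ℝ)
      rw [inv_mul_le_iff₀ (by positivity)]
      linarith
    rw [this, one_mul]

/-! ### Splitting the variation at a level -/

/-- The case of a `C¹` function of compact support, where the two parts of the variation are the
integrals over `{f < k}` and `{f ≥ k}`. -/
lemma ofReal_integral_min_mul_divergence_add_le_of_contDiff (hn : n ≠ 0)
    (hφ : ∀ x, φ x = 0 → x = 0) {f : EuclideanSpace ℝ (Fin n) → ℝ} (hf : ContDiff ℝ 1 f)
    (hfc : HasCompactSupport f) {V : ℝ}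
    (hV : ∀ η, IsTestField φ η → ∫ x, f x * divergence η x ≤ V) {k ρ : ℝ} (hk : 0 < k)
    (hρ : 0 < ρ) (hη : IsTestField φ η) :
    ENNReal.ofReal (∫ x, min (f x) k * divergence η x) + ENNReal.ofReal (n / ρ) *
      ∫⁻ s in Set.Ioi 0,
        min (volume {x | k + s < f x}) (ENNReal.ofReal (ρ ^ n) * volume (φ.closedBall 0 1))
      ≤ ENNReal.ofReal V := by
  have hm : MeasurableSet {x | f x < k} := measurableSet_lt hf.continuous.measurable
    measurable_const
  have hΦ := integrable_dualNorm_fderiv hφ hf hfc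
  have hΦ0 : ∀ x, 0 ≤ dualNorm φ (fderiv ℝ f x) := fun x => dualNorm_nonneg hφ _
  have hc : {x | f x < k}ᶜ = {x | k ≤ f x} := by
    ext x
    simp
  calc _ ≤ ENNReal.ofReal (∫ x in {x | f x < k}, dualNorm φ (fderiv ℝ f x))
        + ∫⁻ x in {x | k ≤ f x}, ENNReal.ofReal (dualNorm φ (fderiv ℝ f x)) :=
        add_le_add (ENNReal.ofReal_le_ofReal (integral_min_mul_divergence_le hφ hη hf hfc k))
          (mul_lintegral_min_le hn hφ hf hfc hk hρ)
    _ = ENNReal.ofReal (∫ x, dualNorm φ (fderiv ℝ f x)) := by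
        rw [ofReal_integral_eq_lintegral_ofReal hΦ.integrableOn (.of_forall hΦ0),
          ofReal_integral_eq_lintegral_ofReal hΦ (.of_forall hΦ0), ← hc, lintegral_add_compl _ hm]
    _ ≤ _ := ENNReal.ofReal_le_ofReal (integral_dualNorm_le hφ hf hfc hV)

/-- Fatou's lemma for superlevel sets. -/
lemma volume_lt_le_liminf {u : EuclideanSpace ℝ (Fin n) → ℝ}
    {f : ℕ → EuclideanSpace ℝ (Fin n) → ℝ} (hf : ∀ j, Continuous (f j))
    (hu : AEMeasurable u) (h : ∀ᵐ x, Tendsto (fun j => f j x) atTop (𝓝 (u x))) (s : ℝ) :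
    volume {x | s < u x} ≤ liminf (fun j => volume {x | s < f j x}) atTop := by
  have hm : ∀ j, MeasurableSet {x | s < f j x} := fun j =>
    (isOpen_lt continuous_const (hf j)).measurableSet
  calc volume {x | s < u x}
      = ∫⁻ x, {x | s < u x}.indicator 1 x :=
        (lintegral_indicator_one₀ (nullMeasurableSet_lt aemeasurable_const hu)).symm
    _ ≤ ∫⁻ x, liminf (fun j => {x | s < f j x}.indicator 1 x) atTop := by
        refine lintegral_mono_ae ?_
        filter_upwards [h] with x hx
        by_cases hs : s < u x
        · refine le_liminf_of_le (by isBoundedDefault) ?_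
          filter_upwards [hx.eventually_const_lt hs] with j hj
          rw [Set.indicator_of_mem (show x ∈ {x | s < u x} from hs),
            Set.indicator_of_mem (show x ∈ {x | s < f j x} from hj)]
        · rw [Set.indicator_of_notMem (show x ∉ {x | s < u x} from hs)]
          exact zero_le
    _ ≤ liminf (fun j => ∫⁻ x, {x | s < f j x}.indicator 1 x) atTop :=
        lintegral_liminf_le fun j => measurable_one.indicator (hm j)
    _ = _ := by simp only [lintegral_indicator_one (hm _)]

/-- The variation of `u` splits at the level `k` into the variation of `min u k` and the perimeters
of the superlevel sets above `k`, the latter being bounded below by the isoperimetric inequality. -/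
lemma ofReal_integral_min_mul_divergence_add_le (hn : n ≠ 0)
    (hφ : ∀ x, φ x = 0 → x = 0) {u : EuclideanSpace ℝ (Fin n) → ℝ}
    (hu : Integrable u) (hu0 : ∀ x, 0 ≤ u x) {V : ℝ}
    (hV : ∀ η, IsTestField φ η → ∫ x, u x * divergence η x ≤ V) {k ρ : ℝ} (hk : 0 < k)
    (hρ : 0 < ρ) (hη : IsTestField φ η) :
    ENNReal.ofReal (∫ x, min (u x) k * divergence η x) + ENNReal.ofReal (n / ρ) *
      ∫⁻ s in Set.Ioi 0,
        min (volume {x | k + s < u x}) (ENNReal.ofReal (ρ ^ n) * volume (φ.closedBall 0 1))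
      ≤ ENNReal.ofReal V := by
  obtain ⟨f, v, hf, hfc, hf0, hfv, hv, hfu⟩ := exists_smooth_approximation hφ hu hu0 hV
  set B := ENNReal.ofReal (ρ ^ n) * volume (φ.closedBall 0 1)
  set I : ℕ → ℝ≥0∞ := fun j => ∫⁻ s in Set.Ioi 0, min (volume {x | k + s < f j x}) B with hI
  set a : ℕ → ℝ := fun j => ∫ x, min (f j x) k * divergence η x with ha
  set a' := ∫ x, min (u x) k * divergence η x with ha'
  have hlim : Tendsto a atTop (𝓝 a') := by
    refine tendsto_integral_of_dominated_convergence (fun x => k * ‖divergence η x‖)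
      (fun j => (((hf j).continuous.min continuous_const).mul
        (continuous_divergence hη.1)).aestronglyMeasurable)
      ((integrable_divergence hη).norm.const_mul k) (fun j => .of_forall fun x => ?_) ?_
    · rw [norm_mul, Real.norm_of_nonneg (le_min (hf0 j x) hk.le)]
      gcongr
      exact min_le_right _ _
    · filter_upwards [hfu] with x hx
      exact (hx.min tendsto_const_nhds).mul_const _
  have hIle : ∫⁻ s in Set.Ioi 0, min (volume {x | k + s < u x}) B ≤ liminf I atTop := by
    have hmeas : ∀ j, Measurable fun s : ℝ => min (volume {x | k + s < f j x}) B := fun j => by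
      have : Antitone fun s : ℝ => volume {x | k + s < f j x} := fun s s' hss =>
        measure_mono fun x (hx : k + s' < f j x) => show k + s < f j x by linarith
      exact this.measurable.min measurable_const
    refine le_trans (lintegral_mono fun s => ?_) (lintegral_liminf_le hmeas)
    have h1 := volume_lt_le_liminf (fun j => (hf j).continuous) hu.aemeasurable hfu (k + s)
    refine le_of_forall_lt fun y hy => ?_
    obtain ⟨z, hyz, hz⟩ := exists_between hy
    refine hyz.trans_le (le_liminf_of_le (by isBoundedDefault) ?_)
    filter_upwards [eventually_lt_of_lt_liminf ((hz.trans_le (min_le_left _ _)).trans_le h1)]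
      with j hj
    exact le_min hj.le (hz.trans_le (min_le_right _ _)).le
  set F : ℝ≥0∞ → ℝ≥0∞ := fun x => ENNReal.ofReal a' + ENNReal.ofReal (n / ρ) * x with hF
  have hFm : Monotone F := fun x y hxy => by
    simp only [hF]
    gcongr
  have hFc : Continuous F :=
    continuous_const.add (ENNReal.continuous_const_mul ENNReal.ofReal_ne_top)
  -- The difference `a' - a j` moves to the right, so that only the integral varies on the left.
  have hFI : ∀ j, F (I j) ≤ ENNReal.ofReal (v j) + ENNReal.ofReal (a' - a j) := fun j => by
    have h1 := ofReal_integral_min_mul_divergence_add_le_of_contDiff hn hφ (hf j) (hfc j)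
      (hfv j) hk hρ hη
    have h2 : ENNReal.ofReal a' ≤ ENNReal.ofReal (a j) + ENNReal.ofReal (a' - a j) := by
      refine le_trans ?_ ENNReal.ofReal_add_le
      simp
    calc F (I j) ≤ (ENNReal.ofReal (a j) + ENNReal.ofReal (a' - a j))
          + ENNReal.ofReal (n / ρ) * I j := by
          simp only [hF]
          gcongr
      _ = (ENNReal.ofReal (a j) + ENNReal.ofReal (n / ρ) * I j) + ENNReal.ofReal (a' - a j) := by
          ring
      _ ≤ _ := by gcongr
  have hvlim : Tendsto (fun j => ENNReal.ofReal (v j) + ENNReal.ofReal (a' - a j)) atTop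
      (𝓝 (ENNReal.ofReal V)) := by
    have h1 := ENNReal.tendsto_ofReal hv
    have h2 := ENNReal.tendsto_ofReal (tendsto_const_nhds (x := a').sub hlim)
    simpa using h1.add h2
  calc _ ≤ F (liminf I atTop) := hFm hIle
    _ = liminf (F ∘ I) atTop := hFm.map_liminf_of_continuousAt _ hFc.continuousAt
    _ ≤ liminf (fun j => ENNReal.ofReal (v j) + ENNReal.ofReal (a' - a j)) atTop :=
        liminf_le_liminf (.of_forall hFI)
    _ = _ := hvlim.liminf_eq

/-! ### The perimeter of a ball of `φ` -/

lemma volume_closedBall_seminorm (φ : Seminorm ℝ (EuclideanSpace ℝ (Fin n)))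
    (x₀ : EuclideanSpace ℝ (Fin n)) {r : ℝ} (hr : 0 < r) :
    volume (φ.closedBall x₀ r) = ENNReal.ofReal (r ^ n) * volume (φ.closedBall 0 1) := by
  have h1 : φ.closedBall x₀ r = (fun x => x + -x₀) ⁻¹' φ.closedBall 0 r := by
    ext x
    simp [Seminorm.mem_closedBall, sub_eq_add_neg]
  have h2 : φ.closedBall 0 r = r • φ.closedBall 0 1 := by
    rw [Seminorm.smul_closedBall_zero (by simpa using hr.ne'), Real.norm_of_nonneg hr.le, mul_one]
  rw [h1, measure_preimage_add_right, h2, Measure.addHaar_smul, finrank_euclideanSpace_fin,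
    abs_of_pos (by positivity)]

lemma isClosed_closedBall_seminorm (φ : Seminorm ℝ (EuclideanSpace ℝ (Fin n)))
    (x₀ : EuclideanSpace ℝ (Fin n)) (r : ℝ) : IsClosed (φ.closedBall x₀ r) :=
  isClosed_le ((continuous_seminorm φ).comp (continuous_id.sub continuous_const)) continuous_const

/-- The cutoff equal to `1` on the ball of radius `r` and decaying linearly to `0` over a distance
`δ`, both measured by `φ`. -/
def ballCutoff (φ : Seminorm ℝ (EuclideanSpace ℝ (Fin n))) (x₀ : EuclideanSpace ℝ (Fin n))
    (r δ : ℝ) (x : EuclideanSpace ℝ (Fin n)) : ℝ :=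
  max 0 (min 1 ((r + δ - φ (x - x₀)) / δ))

lemma abs_ballCutoff_sub_le (φ : Seminorm ℝ (EuclideanSpace ℝ (Fin n)))
    (x₀ : EuclideanSpace ℝ (Fin n)) (r : ℝ) {δ : ℝ} (hδ : 0 < δ) (x y : EuclideanSpace ℝ (Fin n)) :
    |ballCutoff φ x₀ r δ x - ballCutoff φ x₀ r δ y| ≤ δ⁻¹ * φ (x - y) := by
  have h := ((LipschitzWith.id (α := ℝ)).const_min 1).const_max 0 |>.dist_le_mul
    ((r + δ - φ (x - x₀)) / δ) ((r + δ - φ (y - x₀)) / δ)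
  rw [Real.dist_eq, Real.dist_eq, NNReal.coe_one, one_mul] at h
  refine h.trans ?_
  rw [← sub_div, abs_div, abs_of_pos hδ, div_eq_inv_mul]
  gcongr
  rw [sub_sub_sub_cancel_left, abs_sub_comm]
  simpa using abs_sub_map_le_sub φ (x - x₀) (y - x₀)

lemma exists_lipschitzWith_ballCutoff (φ : Seminorm ℝ (EuclideanSpace ℝ (Fin n)))
    (x₀ : EuclideanSpace ℝ (Fin n)) (r : ℝ) {δ : ℝ} (hδ : 0 < δ) :
    ∃ C, LipschitzWith C (ballCutoff φ x₀ r δ) := by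
  obtain ⟨C, hC, h⟩ := exists_seminorm_le_mul_norm φ
  refine ⟨⟨δ⁻¹ * C, by positivity⟩, LipschitzWith.of_dist_le_mul fun x y => ?_⟩
  rw [Real.dist_eq, dist_eq_norm]
  refine (abs_ballCutoff_sub_le φ x₀ r hδ x y).trans ?_
  show _ ≤ δ⁻¹ * C * ‖x - y‖
  rw [mul_assoc]
  gcongr
  exact h _

lemma neg_fderiv_ballCutoff_le (hη : IsTestField φ η) (x₀ : EuclideanSpace ℝ (Fin n)) (r : ℝ)
    {δ : ℝ} (hδ : 0 < δ) (x : EuclideanSpace ℝ (Fin n)) :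
    -(fderiv ℝ (ballCutoff φ x₀ r δ) x (η x))
      ≤ (φ.closedBall x₀ (r + δ) \ φ.closedBall x₀ r).indicator (fun _ => δ⁻¹) x := by
  have hle1 : ∀ y, ballCutoff φ x₀ r δ y ≤ 1 := fun y => max_le zero_le_one (min_le_left _ _)
  have hge0 : ∀ y, 0 ≤ ballCutoff φ x₀ r δ y := fun y => le_max_left _ _
  by_cases hx : x ∈ φ.closedBall x₀ (r + δ) \ φ.closedBall x₀ r
  · rw [Set.indicator_of_mem hx]
    by_cases hd : DifferentiableAt ℝ (ballCutoff φ x₀ r δ) x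
    · have h1 := hd.hasFDerivAt.hasLineDerivAt (η x)
      have h2 := HasDerivAt.le_of_lip' h1 (C := δ⁻¹) (by positivity) (.of_forall fun t => by
        rw [zero_smul, add_zero, Real.norm_eq_abs]
        refine (abs_ballCutoff_sub_le φ x₀ r hδ _ _).trans ?_
        rw [add_sub_cancel_left, map_smul_eq_mul, sub_zero]
        have := hη.2.2 x
        gcongr
        exact mul_le_of_le_one_right (norm_nonneg _) this)
      exact (neg_le_abs _).trans h2
    · rw [fderiv_zero_of_not_differentiableAt hd]
      simpa using hδ.le
  · rw [Set.indicator_of_notMem hx]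
    refine le_of_eq ?_
    suffices fderiv ℝ (ballCutoff φ x₀ r δ) x = 0 by simp [this]
    -- Inside the small ball the cutoff is maximal, and outside the large one it is minimal.
    by_cases hxr : φ (x - x₀) ≤ r
    · have h1 : ballCutoff φ x₀ r δ x = 1 := by
        have : 1 ≤ (r + δ - φ (x - x₀)) / δ := by
          rw [le_div_iff₀ hδ]
          linarith
        rw [ballCutoff, min_eq_left this, max_eq_right zero_le_one]
      have : IsLocalMax (ballCutoff φ x₀ r δ) x := .of_forall fun y => h1 ▸ hle1 y
      exact this.fderiv_eq_zero
    · have hxδ : r + δ < φ (x - x₀) := by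
        by_contra! hcon
        exact hx ⟨by rwa [Seminorm.mem_closedBall], by rwa [Seminorm.mem_closedBall]⟩
      have h1 : ballCutoff φ x₀ r δ x = 0 := by
        have : (r + δ - φ (x - x₀)) / δ ≤ 0 :=
          div_nonpos_of_nonpos_of_nonneg (by linarith) hδ.le
        rw [ballCutoff, max_eq_left ((min_le_right _ _).trans this)]
      have : IsLocalMin (ballCutoff φ x₀ r δ) x := .of_forall fun y => h1 ▸ hge0 y
      exact this.fderiv_eq_zero

/-- The perimeter of a ball of `φ` is at most the derivative of its volume in the radius. -/
lemma setIntegral_closedBall_divergence_le (hφ : ∀ x, φ x = 0 → x = 0) (hη : IsTestField φ η)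
    (x₀ : EuclideanSpace ℝ (Fin n)) {r : ℝ} (hr : 0 < r) :
    ∫ x in φ.closedBall x₀ r, divergence η x
      ≤ n * r ^ (n - 1) * volume.real (φ.closedBall 0 1) := by
  set w := volume.real (φ.closedBall 0 1) with hw
  have hvol : ∀ s, 0 < s → volume.real (φ.closedBall x₀ s) = s ^ n * w := fun s hs => by
    rw [measureReal_def, volume_closedBall_seminorm φ x₀ hs, ENNReal.toReal_mul,
      ENNReal.toReal_ofReal (by positivity)]
    rfl
  have hm : ∀ s, MeasurableSet (φ.closedBall x₀ s) := fun s =>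
    (isClosed_closedBall_seminorm φ x₀ s).measurableSet
  have hfin : ∀ s, volume (φ.closedBall x₀ s) ≠ ∞ := fun s =>
    (isCompact_closedBall_seminorm hφ x₀ s).measure_lt_top.ne
  have hbound : ∀ δ, 0 < δ → ∫ x, ballCutoff φ x₀ r δ x * divergence η x
      ≤ δ⁻¹ • ((r + δ) ^ n * w - r ^ n * w) := by
    intro δ hδ
    obtain ⟨C, hC⟩ := exists_lipschitzWith_ballCutoff φ x₀ r hδ
    have hsub : φ.closedBall x₀ r ⊆ φ.closedBall x₀ (r + δ) :=
      Seminorm.closedBall_mono (by linarith)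
    have hmd : MeasurableSet (φ.closedBall x₀ (r + δ) \ φ.closedBall x₀ r) := (hm _).diff (hm _)
    have hRHS : ∫ x, (φ.closedBall x₀ (r + δ) \ φ.closedBall x₀ r).indicator (fun _ => δ⁻¹) x
        = δ⁻¹ • ((r + δ) ^ n * w - r ^ n * w) := by
      rw [integral_indicator hmd, setIntegral_const, measureReal_sdiff' (hm r) (hfin _) (hfin _),
        Set.union_eq_left.2 hsub, hvol _ hr, hvol _ (by linarith), smul_eq_mul, smul_eq_mul,
        mul_comm]
    rw [integral_mul_divergence hC hη.1 hη.2.1, ← integral_neg, ← hRHS]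
    have hind0 : ∀ x, 0 ≤ (φ.closedBall x₀ (r + δ) \ φ.closedBall x₀ r).indicator
        (fun _ => δ⁻¹) x := fun x => Set.indicator_nonneg (fun _ _ => by positivity) x
    by_cases hi : Integrable fun x => -(fderiv ℝ (ballCutoff φ x₀ r δ) x (η x))
    · refine integral_mono hi ((integrable_indicator_iff hmd).2 (integrableOn_const ?_))
        (neg_fderiv_ballCutoff_le hη x₀ r hδ)
      exact ((measure_mono Set.sdiff_subset).trans_lt (hfin (r + δ)).lt_top).ne
    · rw [integral_undef hi]
      exact integral_nonneg hind0
  have hL : Tendsto (fun δ => ∫ x, ballCutoff φ x₀ r δ x * divergence η x) (𝓝[>] 0)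
      (𝓝 (∫ x in φ.closedBall x₀ r, divergence η x)) := by
    rw [← integral_indicator (hm r)]
    refine tendsto_integral_filter_of_dominated_convergence (fun x => ‖divergence η x‖) ?_ ?_
      (integrable_divergence hη).norm ?_
    · filter_upwards [self_mem_nhdsWithin] with δ hδ
      obtain ⟨C, hC⟩ := exists_lipschitzWith_ballCutoff φ x₀ r hδ
      exact (hC.continuous.mul (continuous_divergence hη.1)).aestronglyMeasurable
    · refine .of_forall fun δ => .of_forall fun x => ?_
      rw [norm_mul]
      refine mul_le_of_le_one_left (norm_nonneg _) ?_
      rw [ballCutoff, Real.norm_of_nonneg (le_max_left _ _)]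
      exact max_le zero_le_one (min_le_left _ _)
    · refine .of_forall fun x => tendsto_const_nhds.congr' ?_
      by_cases hx : φ (x - x₀) ≤ r
      · filter_upwards [self_mem_nhdsWithin] with δ hδ
        have hδ : 0 < δ := hδ
        have : 1 ≤ (r + δ - φ (x - x₀)) / δ := by
          rw [le_div_iff₀ hδ]
          linarith
        rw [Set.indicator_of_mem (by rwa [Seminorm.mem_closedBall]), ballCutoff, min_eq_left this,
          max_eq_right zero_le_one, one_mul]
      · push Not at hx
        filter_upwards [Ioo_mem_nhdsGT (show 0 < φ (x - x₀) - r by linarith)] with δ hδ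
        have : (r + δ - φ (x - x₀)) / δ ≤ 0 :=
          div_nonpos_of_nonpos_of_nonneg (by linarith [hδ.2]) hδ.1.le
        rw [Set.indicator_of_notMem (by rw [Seminorm.mem_closedBall]; linarith), ballCutoff,
          max_eq_left ((min_le_right _ _).trans this), zero_mul]
  have hR : Tendsto (fun δ => δ⁻¹ • ((r + δ) ^ n * w - r ^ n * w)) (𝓝[>] 0)
      (𝓝 (n * r ^ (n - 1) * w)) :=
    ((hasDerivAt_pow n r).mul_const w).tendsto_slope_zero_right
  refine le_of_tendsto_of_tendsto hL hR ?_
  filter_upwards [self_mem_nhdsWithin] with δ hδ using hbound δ hδ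

/-! ### The competitor -/

lemma isTestField_zero : IsTestField φ 0 :=
  ⟨contDiff_const, HasCompactSupport.zero, fun x => by simp⟩

lemma variation_eq_of_ae {Ω : Set (EuclideanSpace ℝ (Fin n))}
    {v : EuclideanSpace ℝ (Fin n) → ℝ} (hv : ∀ᵐ x, x ∉ Ω → v x = 0) :
    variation φ Ω v = variation φ Set.univ v := by
  unfold variation
  congr 1
  ext η
  congr 1
  ext _
  rw [Measure.restrict_univ, setIntegral_eq_integral_of_ae_compl_eq_zero]
  filter_upwards [hv] with x hx hxΩ
  rw [hx hxΩ, zero_mul]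

lemma variation_univ_le_ofReal_iff {v : EuclideanSpace ℝ (Fin n) → ℝ} {V : ℝ} (hV : 0 ≤ V) :
    variation φ Set.univ v ≤ ENNReal.ofReal V ↔
      ∀ η, IsTestField φ η → ∫ x, v x * divergence η x ≤ V := by
  simp only [variation, iSup_le_iff, Measure.restrict_univ, ENNReal.ofReal_le_ofReal_iff hV]

/-- Bounds on the variation transfer between norms: a test field for one norm, divided by a
comparison constant, is a test field for the other. -/
lemma integral_mul_divergence_le_of_le {ψ : Seminorm ℝ (EuclideanSpace ℝ (Fin n))} {C V : ℝ}
    (hC : 0 < C) (h : ∀ x, ψ x ≤ C * φ x) {v : EuclideanSpace ℝ (Fin n) → ℝ}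
    (hV : ∀ η, IsTestField ψ η → ∫ x, v x * divergence η x ≤ V) (hη : IsTestField φ η) :
    ∫ x, v x * divergence η x ≤ C * V := by
  have hη' : IsTestField ψ fun x => C⁻¹ • η x := by
    refine ⟨hη.1.const_smul _, hη.2.1.mono fun x hx h0 => hx (by simp [h0]), fun x => ?_⟩
    rw [map_smul_eq_mul, norm_inv, Real.norm_of_nonneg hC.le, inv_mul_le_iff₀ hC]
    exact (h _).trans (mul_le_mul_of_nonneg_left (hη.2.2 x) hC.le)
  have h1 := hV _ hη'
  have h2 : ∀ x, divergence (fun x => C⁻¹ • η x) x = C⁻¹ * divergence η x := fun x => by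
    rw [divergence_smul contDiff_const hη.1]
    simp
  simp only [h2, mul_left_comm _ C⁻¹, integral_const_mul] at h1
  rwa [inv_mul_le_iff₀ hC] at h1

lemma IsBV.variation_lt_top (hφ : ∀ x, φ x = 0 → x = 0) {u : EuclideanSpace ℝ (Fin n) → ℝ}
    (hu : IsBV u) : variation φ Set.univ u < ∞ := by
  obtain ⟨c, hc, hcφ⟩ := exists_norm_le_mul_seminorm hφ
  have h := (variation_univ_le_ofReal_iff (φ := normSeminorm ℝ (EuclideanSpace ℝ (Fin n)))
    (v := u) ENNReal.toReal_nonneg).1 (ENNReal.ofReal_toReal hu.2.ne).ge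
  refine ((variation_univ_le_ofReal_iff (by positivity)).2 fun η hη =>
    integral_mul_divergence_le_of_le hc hcφ h hη).trans_lt ENNReal.ofReal_lt_top

lemma isBV_of_variation_lt_top {v : EuclideanSpace ℝ (Fin n) → ℝ} (hv : Integrable v)
    (h : variation φ Set.univ v < ∞) : IsBV v := by
  obtain ⟨C, hC, hCφ⟩ := exists_seminorm_le_mul_norm φ
  have h := (variation_univ_le_ofReal_iff (v := v) ENNReal.toReal_nonneg).1
    (ENNReal.ofReal_toReal h.ne).ge
  refine ⟨hv, ((variation_univ_le_ofReal_iff (by positivity)).2 fun η hη =>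
    integral_mul_divergence_le_of_le (φ := normSeminorm ℝ (EuclideanSpace ℝ (Fin n))) hC hCφ h
      hη).trans_lt ENNReal.ofReal_lt_top⟩

lemma integrable_min_const {u : EuclideanSpace ℝ (Fin n) → ℝ} (hu : Integrable u)
    (hu0 : ∀ x, 0 ≤ u x) {k : ℝ} (hk : 0 ≤ k) : Integrable fun x => min (u x) k := by
  refine hu.mono (hu.aestronglyMeasurable.inf aestronglyMeasurable_const) (.of_forall fun x => ?_)
  rw [Real.norm_of_nonneg (le_min (hu0 x) hk), Real.norm_of_nonneg (hu0 x)]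
  exact min_le_left _ _

lemma integrable_max_sub {u : EuclideanSpace ℝ (Fin n) → ℝ} (hu : Integrable u)
    (hu0 : ∀ x, 0 ≤ u x) {k : ℝ} (hk : 0 ≤ k) : Integrable fun x => max (u x - k) 0 := by
  refine hu.mono ((hu.aestronglyMeasurable.sub aestronglyMeasurable_const).sup
    aestronglyMeasurable_const) (.of_forall fun x => ?_)
  rw [Real.norm_of_nonneg (le_max_right _ _), Real.norm_of_nonneg (hu0 x)]
  exact max_le (by linarith) (hu0 x)

/-- For integer values the mass above a level `k` exceeds the volume of `{u > k}`, as long as the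
level `k + 1` is exceeded as well. -/
lemma volume_real_lt_integral_max_sub {u : EuclideanSpace ℝ (Fin n) → ℝ} (hu : Integrable u)
    (hu0 : ∀ x, 0 ≤ u x) (hint : ∀ᵐ x, ∃ j : ℕ, u x = j) {k : ℕ} (hk : 0 < k)
    (hk1 : volume {x | ((k + 1 : ℕ) : ℝ) < u x} ≠ 0) :
    volume.real {x | (k : ℝ) < u x} < ∫ x, max (u x - k) 0 := by
  have hm : ∀ j : ℕ, NullMeasurableSet {x | (j : ℝ) < u x} := fun j =>
    nullMeasurableSet_lt aemeasurable_const hu.aemeasurable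
  have hfin : ∀ j : ℕ, 0 < j → volume {x | (j : ℝ) < u x} ≠ ∞ := fun j hj =>
    (hu.measure_gt_lt_top (by exact_mod_cast hj)).ne
  have hi : ∀ j : ℕ, 0 < j → Integrable ({x | (j : ℝ) < u x}.indicator fun _ => (1 : ℝ)) :=
    fun j hj => (integrableOn_const (hfin j hj)).integrable_indicator₀ (hm j)
  have hval : ∀ j : ℕ, ∫ x, {x | (j : ℝ) < u x}.indicator (fun _ => (1 : ℝ)) x
      = volume.real {x | (j : ℝ) < u x} := fun j => by
    rw [integral_indicator₀ (hm j), setIntegral_const, smul_eq_mul, mul_one]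
  have hpos : 0 < volume.real {x | ((k + 1 : ℕ) : ℝ) < u x} :=
    ENNReal.toReal_pos hk1 (hfin _ k.succ_pos)
  calc volume.real {x | (k : ℝ) < u x}
      < volume.real {x | (k : ℝ) < u x} + volume.real {x | ((k + 1 : ℕ) : ℝ) < u x} := by linarith
    _ = ∫ x, ({x | (k : ℝ) < u x}.indicator (fun _ => (1 : ℝ)) x
          + {x | ((k + 1 : ℕ) : ℝ) < u x}.indicator (fun _ => (1 : ℝ)) x) := by
        rw [integral_add (hi k hk) (hi _ k.succ_pos), hval, hval]
    _ ≤ _ := by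
        refine integral_mono_ae ((hi k hk).add (hi _ k.succ_pos))
          (integrable_max_sub hu hu0 k.cast_nonneg) ?_
        filter_upwards [hint] with x ⟨j, hj⟩
        simp only [Set.indicator_apply, Set.mem_ofPred_eq, hj, Nat.cast_lt]
        split_ifs with h1 h2 h2
        · have : (k : ℝ) + 2 ≤ j := by exact_mod_cast h2
          exact le_max_of_le_left (by linarith)
        · have : (k : ℝ) + 1 ≤ j := by exact_mod_cast h1
          exact le_max_of_le_left (by linarith)
        · omega
        · simp

/-- The superlevel sets above the level `k` lie in `{u > k}`, so the truncation at `B` is void and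
the layer-cake formula gives the mass above the level `k`. -/
lemma lintegral_min_volume_eq {u : EuclideanSpace ℝ (Fin n) → ℝ} (hu : Integrable u) (k : ℝ)
    {B : ℝ≥0∞} (hB : volume {x | k < u x} ≤ B) :
    ∫⁻ s in Set.Ioi 0, min (volume {x | k + s < u x}) B
      = ∫⁻ x, ENNReal.ofReal (max (u x - k) 0) := by
  rw [lintegral_eq_lintegral_meas_lt (f := fun x => max (u x - k) 0) volume
    (.of_forall fun x => le_max_right _ _)
    ((hu.aemeasurable.sub aemeasurable_const).max aemeasurable_const)]
  refine setLIntegral_congr_fun measurableSet_Ioi fun s hs => ?_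
  have hs : 0 < s := hs
  have h1 : {x | s < max (u x - k) 0} = {x | k + s < u x} := by
    ext x
    simp only [Set.mem_ofPred_eq, lt_max_iff, hs.not_gt, or_false, lt_sub_iff_add_lt']
  have h2 : volume {x | k + s < u x} ≤ volume {x | k < u x} :=
    measure_mono fun x (hx : k + s < u x) => show k < u x by linarith
  rw [h1, min_eq_left (h2.trans hB)]

lemma tendsto_integral_max_sub {u : EuclideanSpace ℝ (Fin n) → ℝ} (hu : Integrable u)
    (hu0 : ∀ x, 0 ≤ u x) :
    Tendsto (fun k : ℕ => ∫ x, max (u x - k) 0) atTop (𝓝 0) := by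
  suffices Tendsto (fun k : ℕ => ∫ x, max (u x - k) 0) atTop
      (𝓝 (∫ _ : EuclideanSpace ℝ (Fin n), (0 : ℝ))) by simpa using this
  refine tendsto_integral_of_dominated_convergence u
    (fun k => (integrable_max_sub hu hu0 k.cast_nonneg).aestronglyMeasurable) hu
    (fun k => .of_forall fun x => ?_) (.of_forall fun x => ?_)
  · rw [Real.norm_of_nonneg (le_max_right _ _)]
    exact max_le (by linarith [(k.cast_nonneg : (0 : ℝ) ≤ k)]) (hu0 x)
  · refine tendsto_const_nhds.congr' ?_
    filter_upwards [eventually_ge_atTop ⌈u x⌉₊] with k hk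
    rw [max_eq_right (by linarith [Nat.ceil_le.1 hk])]

lemma exists_closedBall_seminorm_subset (hφ : ∀ x, φ x = 0 → x = 0)
    {Ω : Set (EuclideanSpace ℝ (Fin n))} (hΩ : IsOpen Ω) {x₀ : EuclideanSpace ℝ (Fin n)}
    (hx₀ : x₀ ∈ Ω) : ∃ R > 0, φ.closedBall x₀ R ⊆ Ω := by
  obtain ⟨c, hc, hcφ⟩ := exists_norm_le_mul_seminorm hφ
  obtain ⟨ε, hε, hball⟩ := Metric.isOpen_iff.1 hΩ x₀ hx₀
  refine ⟨ε / (2 * c), by positivity, fun y hy => hball ?_⟩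
  rw [Seminorm.mem_closedBall] at hy
  rw [mem_ball_iff_norm]
  calc ‖y - x₀‖ ≤ c * φ (y - x₀) := hcφ _
    _ ≤ c * (ε / (2 * c)) := by gcongr
    _ = ε / 2 := by field_simp
    _ < ε := half_lt_self hε

/-- The part of an unbounded function above a high level `k` can be replaced by a small ball of the
same mass, at the benefit of its variation. -/
lemma exists_isAdmissible_variation_lt (hn : n ≠ 0) (hφ : ∀ x, φ x = 0 → x = 0)
    {Ω : Set (EuclideanSpace ℝ (Fin n))} (hΩ : IsOpen Ω) {m : ℝ}
    {u : EuclideanSpace ℝ (Fin n) → ℝ} (hu : IsAdmissible Ω m u) (hu0 : ∀ x, 0 ≤ u x)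
    (hunb : ∀ k : ℕ, volume {x | (k : ℝ) < u x} ≠ 0) :
    ∃ v, IsAdmissible Ω m v ∧ variation φ Ω v < variation φ Ω u := by
  have hui : Integrable u := hu.isBV.1
  have hne : Ω.Nonempty := by
    by_contra! he
    refine hunb 0 (measure_mono_null (t := {x | ¬ (x ∉ Ω → u x = 0)}) (fun x hx => ?_)
      (ae_iff.1 hu.eq_zero))
    have hx : ((0 : ℕ) : ℝ) < u x := hx
    simp only [Nat.cast_zero] at hx
    simpa [he] using hx.ne'
  obtain ⟨x₀, hx₀⟩ := hne
  obtain ⟨R, hR, hball⟩ := exists_closedBall_seminorm_subset hφ hΩ hx₀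
  have hWfin : volume (φ.closedBall 0 1) ≠ ∞ :=
    (isCompact_closedBall_seminorm hφ 0 1).measure_lt_top.ne
  set w := volume.real (φ.closedBall 0 1) with hwdef
  have hw : 0 < w := ENNReal.toReal_pos (volume_closedBall_seminorm_pos φ).ne' hWfin
  obtain ⟨k, hεR, hk1⟩ := (((tendsto_integral_max_sub hui hu0).eventually_lt_const
    (show 0 < R ^ n * w by positivity)).and (eventually_ge_atTop 1)).exists
  have hk : (0 : ℝ) < k := by exact_mod_cast hk1
  set ε := ∫ x, max (u x - k) 0 with hεdef
  set a := volume.real {x | (k : ℝ) < u x} with hadef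
  have haε : a < ε := volume_real_lt_integral_max_sub hui hu0 hu.integer_valued hk1 (hunb _)
  have hafin : volume {x | (k : ℝ) < u x} ≠ ∞ := (hui.measure_gt_lt_top hk).ne
  have ha : 0 < a := ENNReal.toReal_pos (hunb k) hafin
  have hε : 0 < ε := ha.trans haε
  -- `ρ` and `r` are the radii of the balls of volumes `a` and `ε`.
  have root : ∀ {y : ℝ}, 0 < y → ∃ s : ℝ, 0 < s ∧ s ^ n * w = y := fun {y} hy => by
    refine ⟨(y / w) ^ (n : ℝ)⁻¹, by positivity, ?_⟩
    rw [Real.rpow_inv_natCast_pow (by positivity) hn, div_mul_cancel₀ _ hw.ne']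
  have root_lt : ∀ {s t : ℝ}, 0 < t → s ^ n * w < t ^ n * w → s < t := fun {s t} ht hst =>
    lt_of_pow_lt_pow_left₀ n ht.le (lt_of_mul_lt_mul_right hst hw.le)
  obtain ⟨ρ, hρ, hρa⟩ := root ha
  obtain ⟨r, hr, hrε⟩ := root hε
  have hρr : ρ < r := root_lt hr (by rwa [hρa, hrε])
  have hrR : r < R := root_lt hR (by rwa [hrε])
  have hrΩ : φ.closedBall x₀ r ⊆ Ω := (Seminorm.closedBall_mono hrR.le).trans hball
  have hBm : MeasurableSet (φ.closedBall x₀ r) := (isClosed_closedBall_seminorm φ x₀ r).measurableSet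
  have hBfin : volume (φ.closedBall x₀ r) ≠ ∞ :=
    (isCompact_closedBall_seminorm hφ x₀ r).measure_lt_top.ne
  have hBvol : volume.real (φ.closedBall x₀ r) = ε := by
    rw [measureReal_def, volume_closedBall_seminorm φ x₀ hr, ENNReal.toReal_mul,
      ENNReal.toReal_ofReal (by positivity)]
    exact hrε
  have hVtop : variation φ Ω u < ∞ := by
    rw [variation_eq_of_ae hu.eq_zero]
    exact hu.isBV.variation_lt_top hφ
  set V := (variation φ Ω u).toReal with hVdef
  have hVu : variation φ Ω u = ENNReal.ofReal V := (ENNReal.ofReal_toReal hVtop.ne).symm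
  have hV0 : 0 ≤ V := ENNReal.toReal_nonneg
  have hV : ∀ η, IsTestField φ η → ∫ x, u x * divergence η x ≤ V := by
    rw [← variation_univ_le_ofReal_iff hV0, ← variation_eq_of_ae hu.eq_zero, hVu]
  have hgain : ∀ η, IsTestField φ η →
      max (∫ x, min (u x) k * divergence η x) 0 + n / ρ * ε ≤ V := by
    intro η hη
    have h1 := ofReal_integral_min_mul_divergence_add_le hn hφ hui hu0 hV hk hρ hη
    have hB : volume {x | (k : ℝ) < u x} ≤
        ENNReal.ofReal (ρ ^ n) * volume (φ.closedBall 0 1) := by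
      rw [← ENNReal.ofReal_toReal hWfin, ← ENNReal.ofReal_mul (by positivity),
        ← ENNReal.ofReal_toReal hafin]
      exact (congrArg ENNReal.ofReal hρa).ge
    rw [lintegral_min_volume_eq hui k hB, ← ofReal_integral_eq_lintegral_ofReal
      (integrable_max_sub hui hu0 hk.le) (.of_forall fun x => le_max_right _ _),
      ← ENNReal.ofReal_mul (by positivity)] at h1
    rw [← ENNReal.ofReal_le_ofReal_iff hV0, ENNReal.ofReal_add (le_max_right _ _) (by positivity)]
    refine le_trans (le_of_eq ?_) h1
    congr 1
    rcases le_total (∫ x, min (u x) k * divergence η x) 0 with h0 | h0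
    · rw [max_eq_right h0, ENNReal.ofReal_zero, ENNReal.ofReal_of_nonpos h0]
    · rw [max_eq_left h0]
  have hgain0 : n / ρ * ε ≤ V := by
    have := hgain 0 isTestField_zero
    linarith [le_max_right (∫ x, min (u x) (k : ℝ) * divergence (0 :
      EuclideanSpace ℝ (Fin n) → EuclideanSpace ℝ (Fin n)) x) 0]
  have hmi := integrable_min_const hui hu0 hk.le
  have hBi : Integrable ((φ.closedBall x₀ r).indicator fun _ => (1 : ℝ)) :=
    (integrable_indicator_iff hBm).2 (integrableOn_const hBfin)
  set v : EuclideanSpace ℝ (Fin n) → ℝ := fun x =>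
    min (u x) k + (φ.closedBall x₀ r).indicator (fun _ => (1 : ℝ)) x with hvdef
  have hvi : Integrable v := hmi.add hBi
  have hv0 : ∀ᵐ x, x ∉ Ω → v x = 0 := by
    filter_upwards [hu.eq_zero] with x hx hxΩ
    have hxB : x ∉ φ.closedBall x₀ r := fun h => hxΩ (hrΩ h)
    simp only [hvdef, Set.indicator_of_notMem hxB, hx hxΩ, min_eq_left hk.le, add_zero]
  have hvV : variation φ Set.univ v ≤ ENNReal.ofReal (V - n / ρ * ε + n / r * ε) := by
    rw [variation_univ_le_ofReal_iff (add_nonneg (by linarith) (by positivity))]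
    intro η hη
    have hper := setIntegral_closedBall_divergence_le hφ hη x₀ hr
    have hper' : n * r ^ (n - 1) * w = n / r * ε := by
      rw [← hrε]
      obtain ⟨l, rfl⟩ := Nat.exists_eq_succ_of_ne_zero hn
      simp only [Nat.succ_eq_add_one, Nat.add_sub_cancel]
      field_simp
      ring
    rw [hper', ← integral_indicator hBm] at hper
    have hsplit : ∫ x, v x * divergence η x = (∫ x, min (u x) k * divergence η x)
        + ∫ x, (φ.closedBall x₀ r).indicator (divergence η) x := by
      rw [← integral_add (integrable_mul_divergence hη hmi)
        ((integrable_divergence hη).indicator hBm)]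
      congr 1
      ext x
      by_cases hx : x ∈ φ.closedBall x₀ r <;> simp [hvdef, hx, add_mul]
    rw [hsplit]
    linarith [hgain η hη, le_max_left (∫ x, min (u x) (k : ℝ) * divergence η x) 0]
  refine ⟨v, ⟨isBV_of_variation_lt_top hvi (hvV.trans_lt ENNReal.ofReal_lt_top), hv0, ?_, ?_⟩, ?_⟩
  · filter_upwards [hu.integer_valued] with x ⟨j, hj⟩
    by_cases hx : x ∈ φ.closedBall x₀ r
    · exact ⟨min j k + 1, by simp [hvdef, hx, hj]⟩
    · exact ⟨min j k, by simp [hvdef, hx, hj]⟩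
  · rw [setIntegral_eq_integral_of_ae_compl_eq_zero hv0]
    have hmass := hu.mass
    rw [setIntegral_eq_integral_of_ae_compl_eq_zero hu.eq_zero] at hmass
    rw [integral_add hmi hBi, integral_indicator hBm, setIntegral_const, hBvol, smul_eq_mul,
      mul_one, hεdef, ← integral_add hmi (integrable_max_sub hui hu0 hk.le), ← hmass]
    congr 1
    ext x
    rcases le_total (u x) k with h | h
    · rw [min_eq_left h, max_eq_right (by linarith), add_zero]
    · rw [min_eq_right h, max_eq_left (by linarith)]
      ring
  · rw [variation_eq_of_ae hv0, hVu]
    refine hvV.trans_lt ?_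
    have hn0 : (0 : ℝ) < n := by exact_mod_cast Nat.pos_of_ne_zero hn
    have hlt : n / r * ε < n / ρ * ε := by gcongr
    have hpos : 0 < n / r * ε := by positivity
    rw [ENNReal.ofReal_lt_ofReal_iff (by linarith)]
    linarith

lemma variation_congr_ae {Ω : Set (EuclideanSpace ℝ (Fin n))}
    {u v : EuclideanSpace ℝ (Fin n) → ℝ} (h : u =ᵐ[volume] v) :
    variation φ Ω u = variation φ Ω v := by
  unfold variation
  congr 1
  ext η
  congr 1
  ext _
  congr 1
  refine integral_congr_ae ?_
  filter_upwards [ae_restrict_of_ae h] with x hx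
  rw [hx]

lemma IsAdmissible.congr_ae {Ω : Set (EuclideanSpace ℝ (Fin n))} {m : ℝ}
    {u v : EuclideanSpace ℝ (Fin n) → ℝ} (hu : IsAdmissible Ω m u) (h : u =ᵐ[volume] v) :
    IsAdmissible Ω m v where
  isBV := ⟨hu.isBV.1.congr h, variation_congr_ae h ▸ hu.isBV.2⟩
  eq_zero := by
    filter_upwards [hu.eq_zero, h] with x hx hxv
    rwa [← hxv]
  integer_valued := by
    filter_upwards [hu.integer_valued, h] with x hx hxv
    rwa [← hxv]
  mass := by
    rw [← hu.mass]
    exact (integral_congr_ae (ae_restrict_of_ae h)).symm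

end AnisoBV

end

theorem mainTheorem8 (n : ℕ) (φ : Seminorm ℝ (EuclideanSpace ℝ (Fin n)))
    (hφ : ∀ x, φ x = 0 → x = 0) (Ω : Set (EuclideanSpace ℝ (Fin n))) (hΩ : IsOpen Ω)
    (m : ℝ) (hm : 0 ≤ m) (u : EuclideanSpace ℝ (Fin n) → ℝ)
    (hu : AnisoBV.IsMinimizer φ Ω m u) :
    MemLp u ∞ volume := by
  have hui : Integrable u := hu.1.isBV.1
  rcases eq_or_ne n 0 with rfl | hn
  · -- `ℝ⁰` is a single point.
    refine memLp_top_of_bound hui.aestronglyMeasurable ‖u 0‖ (.of_forall fun x => ?_)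
    rw [Subsingleton.elim x 0]
  have hae : u =ᵐ[volume] fun x => max (u x) 0 := by
    filter_upwards [hu.1.integer_valued] with x ⟨j, hj⟩
    rw [hj, max_eq_left j.cast_nonneg]
  by_cases hunb : ∀ k : ℕ, volume {x | (k : ℝ) < max (u x) 0} ≠ 0
  · obtain ⟨v, hv, hlt⟩ := AnisoBV.exists_isAdmissible_variation_lt hn hφ hΩ (hu.1.congr_ae hae)
      (fun x => le_max_right _ _) hunb
    rw [← AnisoBV.variation_congr_ae hae] at hlt
    exact absurd (hu.2 v hv) hlt.not_ge
  · push Not at hunb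
    obtain ⟨k, hk⟩ := hunb
    refine memLp_top_of_bound hui.aestronglyMeasurable k ?_
    have hk' : ∀ᵐ x, ¬ (k : ℝ) < max (u x) 0 := by
      rw [ae_iff]
      simp only [not_not]
      exact hk
    filter_upwards [hk', hae] with x hx hxe
    rw [hxe, Real.norm_of_nonneg (le_max_right _ _)]
    exact not_lt.1 hx
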